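/- Let $p$ be an odd prime, $n\ge 0$, and let $\mathbf P=\mathbb F_p[x_1,\dots,x_n]$. The Steenrod powers $P^r$ $(r\ge 0)$ act on $\mathbf P$ as the $\mathbb F_p$-linear operators for which $f\mapsto\sum_{r\ge0}P^r(f)\,t^r$ is the $\mathbb F_p$-algebra homomorphism $\mathbf P\to\mathbf P[t]$ with $x_i\mapsto x_i+x_i^p\,t$. Let $\chi$ be the canonical anti-automorphism (antipode) of the algebra $\mathcal A_p$ of Steenrod $p$th powers, so that $\chi(P^0)=1$ and $\sum_{i+j=r}P^i\chi(P^j)=0$ for $r\ge1$, and put $\widehat P^{\,r}=(-1)^r\chi(P^r)$. Write $p_k=(p^k-1)/(p-1)$ for $k\ge0$, and let $$[x_{a+1},x_{a+2}^{p},\dots,x_{a+s}^{p^{s-1}}]=\det\bigl(x_{a+j}^{p^{i-1}}\bigr)_{1\le i,j\le s},\qquad w(k)=[x_1,x_2^p,\dots,x_k^{p^{k-1}}]$$ (a determinant of size $0$ is $1$). Let $\lambda=(\lambda_1\ge\lambda_2\ge\dots)$ be a partition with at most $n$ nonzero parts, and let $\lambda'$ be its conjugate. Suppose that $\lambda$ is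 $\mathbf T$-regular: $\lambda_i-\lambda_{i+1}\le p-1$ for all $i\ge1$, and for every $a\ge1$ there is at most one $i$ with $(a-1)(p-1)<\lambda_i<a(p-1)$. Its $\mathbf T$-conjugate is $\gamma=(\gamma_1,\dots,\gamma_m)$, where $m=\lceil\lambda_1/(p-1)\rceil$ and $\gamma_k$ is the number of boxes in columns $(k-1)(p-1)+1,\dots,k(p-1)$ of the diagram of $\lambda$. The $k$th antidiagonal of the diagram is the set of boxes $(i,j)$ (row $i$, column $j$, counted from $1$) with $j+i(p-1)=k+p-1$. If it has $s$ boxes and its lowest box is in row $i$, let $v_k(\lambda)=[x_{i-s+1},x_{i-s+2}^{p},\dots,x_i^{p^{s-1}}]$. Put $$v(\lambda)=\prod_{k=1}^{\gamma_1}v_k(\lambda),\qquad w(\lambda')=\prod_{j=1}^{\lambda_1}w(\lambda'_j).$$ For $1\le k\le m$ write $\gamma_k=(n_k-1)(p-1)+b_k$ with $n_k\ge1$ and $1\le b_k\le p-1$, and set $$r_k=(b_k+1)\,p_{n_k-1}-(n_k-1)-\sum_{j=k+1}^m p^{\,j-k-1}\gamma_j .$$ Then every $r_k$ is a non-negative integer,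 and $$\widehat P^{\,r_m}\cdots\widehat P^{\,r_2}\,\widehat P^{\,r_1}\,v(\lambda)=w(\lambda').$$ -/

import Mathlib

open MvPolynomial

noncomputable section

namespace SteenrodLinking

/-- The polynomial algebra `𝔽_p[x_1, …, x_n]`. The variable `x_{i+1}` is `X i`. -/
abbrev Poly (p n : ℕ) : Type := MvPolynomial (Fin n) (ZMod p)

/-! ### Steenrod operations on the polynomial algebra -/

/-- The total Steenrod power `∑_r P^r t^r`: the algebra homomorphism
`𝔽_p[x_1, …, x_n] → 𝔽_p[x_1, …, x_n][t]` with `x_i ↦ x_i + x_i^p t`. -/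
def totalP (p n : ℕ) : Poly p n →ₐ[ZMod p] Polynomial (Poly p n) :=
  MvPolynomial.aeval fun i =>
    Polynomial.C (X i) + Polynomial.C (X i ^ p) * Polynomial.X

/-- The action of the Steenrod power `P^r` on `𝔽_p[x_1, …, x_n]`. That `totalP` is multiplicative
is the Cartan formula; on a variable, `P^0 x = x`, `P^1 x = x^p` and `P^r x = 0` for `r ≥ 2`. -/
def steenrodP (p n r : ℕ) : Module.End (ZMod p) (Poly p n) :=
  ((Polynomial.lcoeff (Poly p n) r).restrictScalars (ZMod p)).comp (totalP p n).toLinearMap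

/-- The action of `χ(P^r)` on `𝔽_p[x_1, …, x_n]`, where `χ` is the canonical anti-automorphism
(the antipode) of the Steenrod algebra. As the coproduct is `P^r ↦ ∑_{i+j=r} P^i ⊗ P^j`,
the antipode is determined by `χ(P^0) = 1` and `∑_{i+j=r} P^i χ(P^j) = 0` for `r ≥ 1`. -/
def chiP (p n : ℕ) : ℕ → Module.End (ZMod p) (Poly p n)
  | 0 => 1
  | r + 1 => -∑ j : Fin (r + 1), steenrodP p n (r + 1 - j) * chiP p n j

/-- The operation `(-1)^r χ(P^r)`. -/
def hatP (p n r : ℕ) : Module.End (ZMod p) (Poly p n) :=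
  (-1 : ZMod p) ^ r • chiP p n r

/-! ### Vandermonde determinants -/

/-- The variable with index `i` (counted from `0`), with the unused value `0` for `i ≥ n`. -/
def var (p n i : ℕ) : Poly p n :=
  if h : i < n then X ⟨i, h⟩ else 0

/-- The `s × s` determinant `[x_{a+1}, x_{a+2}^p, …, x_{a+s}^{p^{s-1}}]` (named by its diagonal),
whose rows are the `p^0, p^1, …, p^{s-1}`-th powers of the variables `x_{a+1}, …, x_{a+s}`. -/
def vdm (p n a s : ℕ) : Poly p n :=
  Matrix.det (Matrix.of fun i j : Fin s => var p n (a + j) ^ p ^ (i : ℕ))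

/-- `w(k) = [x_1, x_2^p, …, x_k^{p^{k-1}}]`. -/
def w (p n k : ℕ) : Poly p n := vdm p n 0 k

/-! ### Partitions

A partition `λ` is given by its Young diagram, whose boxes `(i, j)` are counted from `(0, 0)`:
`lam.rowLen i` is the part `λ_{i+1}` (and `0` beyond the last part), and `lam.colLen j` is the part
`λ'_{j+1}` of the conjugate partition. -/

/-- Column `p`-regular: `λ_i - λ_{i+1} ≤ p - 1` for all `i`. -/
def ColumnRegular (p : ℕ) (lam : YoungDiagram) : Prop :=
  ∀ i, lam.rowLen i ≤ lam.rowLen (i + 1) + (p - 1)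

/-- `T`-regular: column `p`-regular, and for each `a ≥ 1` there is at most one `i` with
`(a - 1)(p - 1) < λ_i < a(p - 1)`. -/
def TRegular (p : ℕ) (lam : YoungDiagram) : Prop :=
  ColumnRegular p lam ∧
    ∀ a, 1 ≤ a → ∀ i i',
      ((a - 1) * (p - 1) < lam.rowLen i ∧ lam.rowLen i < a * (p - 1)) →
      ((a - 1) * (p - 1) < lam.rowLen i' ∧ lam.rowLen i' < a * (p - 1)) → i = i'

/-- The part `γ_k` (`k ≥ 1`) of the `T`-conjugate: the number of boxes of `λ` in the `k`-th block
of `p - 1` consecutive columns. -/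
def tConj (p : ℕ) (lam : YoungDiagram) (k : ℕ) : ℕ :=
  (lam.cells.filter fun c => (k - 1) * (p - 1) ≤ c.2 ∧ c.2 < k * (p - 1)).card

/-- The length of the `T`-conjugate: the number `⌈λ_1 / (p - 1)⌉` of blocks of `p - 1` columns. -/
def tConjLength (p : ℕ) (lam : YoungDiagram) : ℕ :=
  lam.rowLen 0 ⌈/⌉ (p - 1)

/-- The `k`-th antidiagonal (`k ≥ 1`): the boxes in row `i` and column `j`, counted from `1`, such
that `j + i(p - 1) = k + p - 1`. -/
def antidiag (p : ℕ) (lam : YoungDiagram) (k : ℕ) : Finset (ℕ × ℕ) :=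
  lam.cells.filter fun c => (c.2 + 1) + (c.1 + 1) * (p - 1) = k + (p - 1)

/-- `v_k(λ) = [x_{i-s+1}, x_{i-s+2}^p, …, x_i^{p^{s-1}}]`, where `s` is the number of boxes in the
`k`-th antidiagonal and `i` (counted from `1`) is the row of its lowest box. -/
def vPart (p n : ℕ) (lam : YoungDiagram) (k : ℕ) : Poly p n :=
  vdm p n ((antidiag p lam k).sup Prod.fst + 1 - (antidiag p lam k).card) (antidiag p lam k).card

/-- `v(λ) = ∏_{k=1}^{γ_1} v_k(λ)`. -/
def v (p n : ℕ) (lam : YoungDiagram) : Poly p n :=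
  ∏ k ∈ Finset.Icc 1 (tConj p lam 1), vPart p n lam k

/-- `w(λ') = ∏_{j=1}^{λ_1} w(λ'_j)`. -/
def wConj (p n : ℕ) (lam : YoungDiagram) : Poly p n :=
  ∏ j ∈ Finset.range (lam.rowLen 0), w p n (lam.colLen j)

/-- `p_k = (p^k - 1)/(p - 1)`; the division is exact. -/
def pNum (p k : ℕ) : ℕ := (p ^ k - 1) / (p - 1)

/-- The composite `Ĥ^{r_m} ⋯ Ĥ^{r_2} Ĥ^{r_1}` of the operations `Ĥ^r = (-1)^r χ(P^r)`. -/
def hatComposite (p n : ℕ) (r : ℕ → ℕ) : ℕ → Module.End (ZMod p) (Poly p n)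
  | 0 => 1
  | m + 1 => hatP p n (r (m + 1)) * hatComposite p n r m

end SteenrodLinking

end

/-!
Let `d = p - 1`. On a variable the total operation `∑_r (-1)^r χ(P^r) t^r` is
`x ↦ η = ∑_k x^{p^k} t^{p_k}`, the inverse of the total Steenrod power with `t ↦ -t`
(`coeff_hatTotal`). As `η = x + t η^p`, row operations show that on a determinant
`[x_{a+1}, …, x_{a+s}^{p^{s-1}}]` it acts, up to the factor `t^{p_{s-1}}`, by replacing the last row
by the `η`'s (`X_pow_dvd_hatTotal_vdm_sub_vdmTop`). So `t^{∑ p_{s_k - 1}}` times the image of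
`v(λ) = ∏ v_k(λ)` is a product of `γ_1` linear combinations of the `η`'s, and `(-1)^r χ(P^r) v(λ)`
is one of its coefficients, that of `t^T` say.

For each `t^T` that occurs in the product, `(p-1)T + γ_1` is a sum of `γ_1` powers of `p`, one from
each factor. For `r = r_1` it is `(b_1 + 1) p^{n_1 - 1} - 1`, whose digit sum is exactly `γ_1`, so
that no shorter sum of powers of `p` exists. Hence terms divisible by some `η_j^p` do not contribute,
because `η_j^p = ∑ x_j^{p^{k+1}} t^{p p_k}` has one power of `p` where a product of `p` general
factors has `p`. The rows of the first `d` columns of `λ` being full but for the last one,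
only the leading cofactor of each determinant survives (`prod_vdmTop_sub_mem_defect`):
the result is the product of these cofactors, which is `v` of the diagram with its first `d` columns
removed, times a factor that is the same whatever the sizes of the determinants
(`hatP_prod_vdm_eq`). That factor is found from the largest sizes, where the operation is
the identity: it is `w(n_1)^{b_1} w(n_1 - 1)^{d - b_1}`, the product of the `w(λ'_j)` over the first
`d` columns (`coeff_prod_hatTotal_var`, `prod_w_colLen`).

By induction on the number of blocks of `d` columns it remains to see that this factor passes
through the later operations. The first operation `(-1)^r χ(P^r)` with `r ≥ 1` that can be
nonzero on `w(s + 1)` has `r = p^s`, and the later degrees are smaller than that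
(`exists_hatConstBelow`), since `γ_k + d ≤ γ_1` for `k ≥ 2`.
-/

open MvPolynomial

namespace SteenrodLinking

/-! ### The conjugate operations as coefficients of an algebra homomorphism -/

lemma pNum_eq_sum {p : ℕ} (hp : 2 ≤ p) (k : ℕ) : pNum p k = ∑ i ∈ Finset.range k, p ^ i :=
  (Nat.geomSum_eq hp k).symm

lemma pNum_zero (p : ℕ) : pNum p 0 = 0 := by simp [pNum]

lemma pNum_succ {p : ℕ} (hp : 2 ≤ p) (k : ℕ) : pNum p (k + 1) = pNum p k + p ^ k := by
  rw [pNum_eq_sum hp, pNum_eq_sum hp, Finset.sum_range_succ]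

lemma pNum_succ' {p : ℕ} (hp : 2 ≤ p) (k : ℕ) : pNum p (k + 1) = p * pNum p k + 1 := by
  induction k with
  | zero => simp [pNum_succ hp, pNum_zero]
  | succ k ih =>
    rw [pNum_succ hp, ih, pow_succ']
    nth_rw 2 [← ih]
    rw [pNum_succ hp]
    ring

lemma sub_one_mul_pNum {p : ℕ} (hp : 2 ≤ p) (k : ℕ) : (p - 1) * pNum p k + 1 = p ^ k := by
  obtain ⟨q, rfl⟩ : ∃ q, p = q + 1 := ⟨p - 1, by omega⟩
  induction k with
  | zero => simp [pNum_zero]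
  | succ k ih => 
    rw [pNum_succ hp, mul_add, pow_succ]
    simp only [Nat.add_sub_cancel] at ih ⊢
    linarith

lemma le_pNum {p : ℕ} (hp : 2 ≤ p) (k : ℕ) : k ≤ pNum p k := by
  induction k with
  | zero => simp
  | succ k ih => rw [pNum_succ hp]; have := Nat.one_le_pow k p (by omega); omega

lemma pNum_mono {p : ℕ} (hp : 2 ≤ p) : Monotone (pNum p) :=
  monotone_nat_of_le_succ fun k => by rw [pNum_succ hp]; omega

/-- The sum of the operations `(-1)^r χ(P^r)`, up to a high power of `t`: the algebra homomorphism
with `x ↦ ∑_{k < K} x^{p^k} t^{p_k}` on the variables. The truncation at `k < K` keeps the values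
polynomial in `t`; only congruences modulo `t^K` are meaningful. -/
noncomputable def hatTotal (p n K : ℕ) : Poly p n →ₐ[ZMod p] Polynomial (Poly p n) :=
  MvPolynomial.aeval fun i => ∑ k ∈ Finset.range K,
    Polynomial.C (X i ^ p ^ k) * Polynomial.X ^ pNum p k

lemma hatTotal_var (p n K i : ℕ) [Fact p.Prime] : hatTotal p n K (var p n i) =
    ∑ k ∈ Finset.range K, Polynomial.C (var p n i ^ p ^ k) * Polynomial.X ^ pNum p k := by
  have hp := (Fact.out : p.Prime).pos
  unfold var
  split
  · simp [hatTotal]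
  · rw [map_zero, Finset.sum_eq_zero]
    intro k _
    rw [zero_pow (pow_pos hp k).ne', map_zero, zero_mul]

lemma hatTotal_C (p n K : ℕ) (a : ZMod p) : hatTotal p n K (C a) = Polynomial.C (C a) := by
  simp [hatTotal]

lemma steenrodP_apply (p n r : ℕ) (f : Poly p n) : steenrodP p n r f = (totalP p n f).coeff r :=
  rfl

lemma steenrodP_zero (p n : ℕ) : steenrodP p n 0 = 1 := by
  refine LinearMap.ext fun f => ?_
  rw [steenrodP_apply, Module.End.one_apply]
  induction f using MvPolynomial.induction_on with
  | C a =>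
    have : totalP p n (C a) = Polynomial.C (C a) := by simp [totalP]
    simp [this]
  | add f g hf hg => simp [hf, hg]
  | mul_X f i hf => rw [map_mul, Polynomial.mul_coeff_zero, hf]; simp [totalP]

/-- The extension of the total Steenrod power to a ring endomorphism of `P[t]` with `t ↦ -t`.
It is inverse to `hatTotal` modulo a power of `t`. -/
noncomputable def totalPExt (p n : ℕ) : Polynomial (Poly p n) →+* Polynomial (Poly p n) :=
  Polynomial.eval₂RingHom (totalP p n).toRingHom (-Polynomial.X)

lemma coeff_totalPExt (p n r : ℕ) (F : Polynomial (Poly p n)) :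
    (totalPExt p n F).coeff r =
      ∑ j ∈ Finset.range (r + 1), (-1) ^ j * steenrodP p n (r - j) (F.coeff j) := by
  induction F using Polynomial.induction_on' with
  | add F G hF hG => simp [hF, hG, mul_add, Finset.sum_add_distrib]
  | monomial k a =>
    have h1 : totalPExt p n (Polynomial.monomial k a) =
        Polynomial.C ((-1) ^ k) * (totalP p n a * Polynomial.X ^ k) := by
      simp only [totalPExt, Polynomial.coe_eval₂RingHom, Polynomial.eval₂_monomial]
      rw [neg_pow (Polynomial.X : Polynomial (Poly p n)), map_pow, map_neg, map_one]
      simp only [AlgHom.toRingHom_eq_coe, RingHom.coe_coe]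
      ring
    rw [h1, Polynomial.coeff_C_mul, Polynomial.coeff_mul_X_pow']
    simp only [Polynomial.coeff_monomial]
    split
    · rename_i h
      rw [Finset.sum_eq_single k]
      · simp [steenrodP_apply]
      · intro j _ hj; simp [Ne.symm hj]
      · intro hk; simp at hk; omega
    · rename_i h
      rw [Finset.sum_eq_zero, mul_zero]
      intro j hj
      have : k ≠ j := by simp at hj; omega
      simp [this]

lemma neg_one_pow_pNum {p : ℕ} (hp : 2 ≤ p) (hodd : Odd p) {R : Type*} [CommRing R] (k : ℕ) :
    (-1 : R) ^ pNum p k = (-1) ^ k := by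
  induction k with
  | zero => simp [pNum_zero]
  | succ k ih => rw [pNum_succ hp, pow_add, ih, (hodd.pow).neg_one_pow, pow_succ]

lemma totalPExt_hatTotal_X (p n K : ℕ) [Fact p.Prime] (hp2 : p ≠ 2) (i : Fin n) :
    totalPExt p n (hatTotal p n K (X i)) =
      Polynomial.C (X i : Poly p n) -
        (-1) ^ K * (Polynomial.C ((X i : Poly p n) ^ p ^ K) * Polynomial.X ^ pNum p K) := by
  have hp : p.Prime := Fact.out
  induction K with
  | zero => simp [hatTotal, pNum_zero]
  | succ K ih =>
    have h : hatTotal p n (K + 1) (X i) = hatTotal p n K (X i) +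
        Polynomial.C ((X i : Poly p n) ^ p ^ K) * Polynomial.X ^ pNum p K := by
      simp [hatTotal, Finset.sum_range_succ]
    have h2 : totalPExt p n (Polynomial.C ((X i : Poly p n) ^ p ^ K)) =
        Polynomial.C ((X i : Poly p n) ^ p ^ K) +
          Polynomial.C ((X i : Poly p n) ^ p ^ (K + 1)) * Polynomial.X ^ p ^ K := by
      simp only [totalPExt, Polynomial.coe_eval₂RingHom, Polynomial.eval₂_C, totalP,
        AlgHom.toRingHom_eq_coe, RingHom.coe_coe, map_pow, aeval_X]
      rw [add_pow_char_pow, mul_pow]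
      ring
    have h3 : totalPExt p n Polynomial.X = -Polynomial.X := by simp [totalPExt]
    rw [h, map_add, ih, map_mul, h2, map_pow (totalPExt p n), h3,
      neg_pow (Polynomial.X : Polynomial (Poly p n)), neg_one_pow_pNum hp.two_le
      (hp.odd_of_ne_two hp2), pNum_succ hp.two_le]
    ring

lemma X_pow_dvd_totalPExt_hatTotal (p n K : ℕ) [Fact p.Prime] (hp2 : p ≠ 2) (f : Poly p n) :
    Polynomial.X ^ K ∣ totalPExt p n (hatTotal p n K f) - Polynomial.C f := by
  have hp : p.Prime := Fact.out
  rw [← Ideal.mem_span_singleton, ← Ideal.Quotient.eq]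
  set π := Ideal.Quotient.mk (Ideal.span {(Polynomial.X ^ K : Polynomial (Poly p n))})
  suffices h : (π.comp (totalPExt p n)).comp (hatTotal p n K).toRingHom = π.comp Polynomial.C from
    congrArg (fun φ : Poly p n →+* _ => φ f) h
  refine MvPolynomial.ringHom_ext (fun a => ?_) (fun i => ?_)
  · simp only [AlgHom.toRingHom_eq_coe, RingHom.comp_apply, RingHom.coe_coe, hatTotal_C]
    simp [totalPExt, totalP]
  · simp only [AlgHom.toRingHom_eq_coe, RingHom.comp_apply, RingHom.coe_coe]
    rw [totalPExt_hatTotal_X p n K hp2, Ideal.Quotient.eq, Ideal.mem_span_singleton]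
    rw [sub_sub_cancel_left, ← mul_assoc, ← neg_mul]
    exact Dvd.dvd.mul_left (pow_dvd_pow Polynomial.X (le_pNum hp.two_le K)) _

/-- The coefficients of `hatTotal` below the truncation satisfy the recursion defining the
antipode, hence are the operations `(-1)^r χ(P^r)`. -/
lemma coeff_hatTotal (p n K r : ℕ) [Fact p.Prime] (hp2 : p ≠ 2) (hr : r < K) (f : Poly p n) :
    (hatTotal p n K f).coeff r = hatP p n r f := by
  have key : ∀ r < K, ∑ j ∈ Finset.range (r + 1),
      (-1) ^ j * steenrodP p n (r - j) ((hatTotal p n K f).coeff j) = if r = 0 then f else 0 := by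
    intro r hr
    have := Polynomial.X_pow_dvd_iff.1 (X_pow_dvd_totalPExt_hatTotal p n K hp2 f) r hr
    rwa [Polynomial.coeff_sub, coeff_totalPExt, Polynomial.coeff_C, sub_eq_zero] at this
  have chi : ∀ r < K, chiP p n r f = (-1) ^ r * (hatTotal p n K f).coeff r := by
    intro r
    induction r using Nat.strong_induction_on with
    | _ r ih =>
      intro hr
      cases r with
      | zero =>
        have := key 0 hr
        simp only [zero_add, Finset.range_one, Finset.sum_singleton, pow_zero, one_mul,
          Nat.sub_zero, steenrodP_zero, Module.End.one_apply, if_true] at this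
        rw [chiP, Module.End.one_apply, this, pow_zero, one_mul]
      | succ r =>
        have h := key (r + 1) hr
        rw [Finset.sum_range_succ, Nat.sub_self, steenrodP_zero, Module.End.one_apply,
          if_neg (Nat.succ_ne_zero r), add_eq_zero_iff_neg_eq] at h
        rw [← h, chiP, LinearMap.neg_apply, LinearMap.sum_apply,
          ← Fin.sum_univ_eq_sum_range (fun j => (-1) ^ j *
            steenrodP p n (r + 1 - j) ((hatTotal p n K f).coeff j))]
        refine congrArg Neg.neg (Finset.sum_congr rfl fun j _ => ?_)
        rw [Module.End.mul_apply, ih j (by omega) (by omega)]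
        rcases neg_one_pow_eq_or (Poly p n) (j : ℕ) with h | h <;> rw [h] <;> simp
  rw [hatP, LinearMap.smul_apply, chi r hr, ← mul_smul_comm]
  rcases Nat.even_or_odd r with h | h <;> simp [h.neg_one_pow]

/-! ### Determinants of Moore type -/

section Moore
variable {A : Type*} [CommRing A] {p s : ℕ} {ξ η : Fin (s + 1) → A} {u : A}

/-- Row operations, from the top down, replace `η^{p^i}` by `ξ^{p^i}` in every row but the last. -/
lemma det_moore_eq_updateRow
    (h : ∀ (i : ℕ) j, η j ^ p ^ i = ξ j ^ p ^ i + u ^ p ^ i * η j ^ p ^ (i + 1)) :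
    Matrix.det (Matrix.of fun i j : Fin (s + 1) => η j ^ p ^ (i : ℕ)) =
      Matrix.det (Matrix.updateRow (Matrix.of fun i j : Fin (s + 1) => ξ j ^ p ^ (i : ℕ))
        (Fin.last s) fun j => η j ^ p ^ s) := by
  -- `M k` has `ξ` in its first `k` rows and `η` in the others.
  let M : ℕ → Matrix (Fin (s + 1)) (Fin (s + 1)) A := fun k =>
    Matrix.of fun i j => if (i : ℕ) < k then ξ j ^ p ^ (i : ℕ) else η j ^ p ^ (i : ℕ)
  have step : ∀ k ≤ s, (M 0).det = (M k).det := by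
    intro k
    induction k with
    | zero => intro _; rfl
    | succ k ih =>
      intro hk
      rw [ih (by omega), ← Matrix.det_updateRow_add_smul_self (M (k + 1))
        (i := ⟨k, by omega⟩) (j := ⟨k + 1, by omega⟩) (by simp) (u ^ p ^ k)]
      congr 1
      ext i j
      by_cases hi : i = ⟨k, by omega⟩
      · subst hi
        simp [M, h k j]
      · have hi' : (i : ℕ) ≠ k := fun hc => hi (Fin.ext hc)
        rw [Matrix.updateRow_ne hi]
        simp only [M, Matrix.of_apply]
        congr 1
        simp only [eq_iff_iff]
        omega
  have h0 : (Matrix.of fun i j : Fin (s + 1) => η j ^ p ^ (i : ℕ)) = M 0 := by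
    ext i j; simp [M]
  rw [h0, step s le_rfl]
  congr 1
  ext i j
  by_cases hi : i = Fin.last s
  · subst hi; simp [M]
  · rw [Matrix.updateRow_ne hi]
    have : (i : ℕ) < s := Fin.val_lt_last hi
    simp [M, this]

/-- Up to a power of `u`, the last row `η^{p^s}` may be replaced by `η`: the terms of `η` that this
adds are multiples of the other rows. -/
lemma pow_mul_det_updateRow_moore (hp : 2 ≤ p)
    (h : ∀ (i : ℕ) j, η j ^ p ^ i = ξ j ^ p ^ i + u ^ p ^ i * η j ^ p ^ (i + 1)) :
    u ^ pNum p s *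
        Matrix.det (Matrix.updateRow (Matrix.of fun i j : Fin (s + 1) => ξ j ^ p ^ (i : ℕ))
          (Fin.last s) fun j => η j ^ p ^ s) =
      Matrix.det (Matrix.updateRow (Matrix.of fun i j : Fin (s + 1) => ξ j ^ p ^ (i : ℕ))
        (Fin.last s) η) := by
  set Ξ : Matrix (Fin (s + 1)) (Fin (s + 1)) A := Matrix.of fun i j => ξ j ^ p ^ (i : ℕ) with hΞ
  have step : ∀ k ≤ s, u ^ pNum p k * (Ξ.updateRow (Fin.last s) fun j => η j ^ p ^ k).det =
      (Ξ.updateRow (Fin.last s) η).det := by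
    intro k
    induction k with
    | zero => intro _; simp [pNum_zero]
    | succ k ih =>
      intro hk
      have hrow : (fun j => η j ^ p ^ k) =
          Ξ ⟨k, by omega⟩ + u ^ p ^ k • fun j => η j ^ p ^ (k + 1) := by
        ext j
        simp [hΞ, h k j]
      rw [← ih (by omega), hrow, Matrix.det_updateRow_add, Matrix.det_updateRow_smul,
        Matrix.det_updateRow_eq_zero (by intro hc; have := congrArg Fin.val hc; simp at this; omega),
        pNum_succ hp, pow_add]
      ring
  exact step s le_rfl

/-- Replacing `η` by `ξ` changes only the last row, and that by a multiple of `u^{p^s}`. -/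
lemma pow_dvd_det_moore_sub
    (h : ∀ (i : ℕ) j, η j ^ p ^ i = ξ j ^ p ^ i + u ^ p ^ i * η j ^ p ^ (i + 1)) :
    u ^ p ^ s ∣ Matrix.det (Matrix.of fun i j : Fin (s + 1) => η j ^ p ^ (i : ℕ)) -
      Matrix.det (Matrix.of fun i j : Fin (s + 1) => ξ j ^ p ^ (i : ℕ)) := by
  rw [det_moore_eq_updateRow h]
  have hrow : (fun j => η j ^ p ^ s) =
      (Matrix.of fun i j : Fin (s + 1) => ξ j ^ p ^ (i : ℕ)) (Fin.last s) +
        u ^ p ^ s • fun j => η j ^ p ^ (s + 1) := by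
    ext j
    simp [h s j]
  rw [hrow, Matrix.det_updateRow_add, Matrix.det_updateRow_smul, Matrix.updateRow_eq_self,
    add_sub_cancel_left]
  exact dvd_mul_right _ _

/-- Laplace expansion along the last row, with the leading cofactor made explicit. -/
lemma exists_det_updateRow_last_eq {B : Type*} [CommRing B] (φ : B →+* A)
    (M : Matrix (Fin (s + 1)) (Fin (s + 1)) B) (x : Fin (s + 1) → A) : ∃ c : Fin s → B,
    Matrix.det (Matrix.updateRow (M.map φ) (Fin.last s) x) =
      φ (Matrix.det (M.submatrix Fin.castSucc Fin.castSucc)) * x (Fin.last s) +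
        ∑ j : Fin s, φ (c j) * x (Fin.castSucc j) := by
  refine ⟨fun j => (-1) ^ (s + j : ℕ) *
    Matrix.det (M.submatrix Fin.castSucc (Fin.castSucc j).succAbove), ?_⟩
  have hsub : ∀ j, ((M.map φ).updateRow (Fin.last s) x).submatrix (Fin.last s).succAbove j =
      φ.mapMatrix (M.submatrix Fin.castSucc j) := by
    intro j
    ext i k
    simp
  rw [Matrix.det_succ_row _ (Fin.last s), Fin.sum_univ_castSucc, add_comm]
  simp only [hsub, ← RingHom.map_det, Matrix.updateRow_self, Fin.val_last, Fin.val_castSucc]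
  congr 1
  · rw [← two_mul, (even_two_mul _).neg_one_pow, one_mul, mul_comm, Fin.succAbove_last]
  · refine Finset.sum_congr rfl fun j _ => ?_
    rw [map_mul, map_pow, map_neg, map_one]
    ring

end Moore

section HatTotalVdm
variable (p n K : ℕ)

/-- The relation `η = x + t η^p`, satisfied modulo `t^K` by the image `η` of a variable `x` under
`hatTotal`, after raising to the power `p^i`. -/
lemma X_pow_dvd_hatTotal_var [Fact p.Prime] (i a : ℕ) :
    Polynomial.X ^ K ∣ hatTotal p n K (var p n a) ^ p ^ i -
      (Polynomial.C (var p n a) ^ p ^ i +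
        Polynomial.X ^ p ^ i * hatTotal p n K (var p n a) ^ p ^ (i + 1)) := by
  have hp : p.Prime := Fact.out
  have h1 : hatTotal p n K (var p n a) -
      (Polynomial.C (var p n a) + Polynomial.X * hatTotal p n K (var p n a) ^ p) =
      - (Polynomial.C (var p n a ^ p ^ K) * Polynomial.X ^ pNum p K) := by
    have h2 : Polynomial.X * hatTotal p n K (var p n a) ^ p =
        ∑ k ∈ Finset.range K,
          Polynomial.C (var p n a ^ p ^ (k + 1)) * Polynomial.X ^ pNum p (k + 1) := by
      rw [hatTotal_var, sum_pow_char, Finset.mul_sum]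
      refine Finset.sum_congr rfl fun k _ => ?_
      rw [pNum_succ' hp.two_le, mul_pow, ← map_pow, ← pow_mul, ← pow_mul, ← pow_succ,
        pow_succ Polynomial.X, mul_comm p]
      ring
    rw [h2, hatTotal_var]
    have h3 := Finset.sum_range_succ (fun k =>
      (Polynomial.C (var p n a ^ p ^ k) * Polynomial.X ^ pNum p k : Polynomial (Poly p n))) K
    rw [Finset.sum_range_succ'] at h3
    simp only [pow_zero, pow_one, pNum_zero, mul_one] at h3
    linear_combination -h3
  have h4 : hatTotal p n K (var p n a) ^ p ^ i -
      (Polynomial.C (var p n a) ^ p ^ i +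
        Polynomial.X ^ p ^ i * hatTotal p n K (var p n a) ^ p ^ (i + 1)) =
      (hatTotal p n K (var p n a) -
        (Polynomial.C (var p n a) + Polynomial.X * hatTotal p n K (var p n a) ^ p)) ^ p ^ i := by
    rw [sub_pow_char_pow, add_pow_char_pow, mul_pow, ← pow_mul, ← pow_succ']
  rw [h4, h1]
  refine Dvd.dvd.trans ?_ (dvd_pow_self _ (pow_pos hp.pos i).ne')
  obtain ⟨c, hc⟩ := pow_dvd_pow (Polynomial.X : Polynomial (Poly p n)) (le_pNum hp.two_le K)
  exact ⟨-(Polynomial.C (var p n a ^ p ^ K) * c), by rw [hc]; ring⟩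

/-- The quotient `R[t] ⧸ (t^K)`, as an abstract ring. -/
lemma exists_quotient_X_pow {R : Type} [CommRing R] (K : ℕ) :
    ∃ (A : Type) (_ : CommRing A) (π : Polynomial R →+* A), Function.Surjective π ∧
      ∀ f, π f = 0 ↔ Polynomial.X ^ K ∣ f :=
  ⟨_, _, Ideal.Quotient.mk (Ideal.span {Polynomial.X ^ K}), Ideal.Quotient.mk_surjective,
    fun _ => Ideal.Quotient.eq_zero_iff_mem.trans Ideal.mem_span_singleton⟩

lemma map_hatTotal_var_pow [Fact p.Prime] {A : Type*} [CommRing A]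
    (π : Polynomial (Poly p n) →+* A) (hπ : ∀ f, π f = 0 ↔ Polynomial.X ^ K ∣ f) (i a : ℕ) :
    π (hatTotal p n K (var p n a)) ^ p ^ i = π (Polynomial.C (var p n a)) ^ p ^ i +
      π Polynomial.X ^ p ^ i * π (hatTotal p n K (var p n a)) ^ p ^ (i + 1) := by
  have := (hπ _).2 (X_pow_dvd_hatTotal_var p n K i a)
  simpa [sub_eq_zero] using this

/-- The determinant `[x_{a+1}, …, x_{a+s}^{p^{s-1}}, x_{a+s+1}^{p^s}]`, over `P[t]`, with its last
row replaced by the images of the variables under `hatTotal`. -/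
noncomputable def vdmTop (a s : ℕ) : Polynomial (Poly p n) :=
  Matrix.det (Matrix.updateRow
    (Matrix.of fun i j : Fin (s + 1) => Polynomial.C (var p n (a + j)) ^ p ^ (i : ℕ))
    (Fin.last s) fun j => hatTotal p n K (var p n (a + j)))

lemma hatTotal_vdm (a s : ℕ) : hatTotal p n K (vdm p n a s) =
    Matrix.det (Matrix.of fun i j : Fin s => hatTotal p n K (var p n (a + j)) ^ p ^ (i : ℕ)) := by
  rw [vdm, AlgHom.map_det]
  congr 1
  ext i j : 2
  simp

lemma C_vdm (a s : ℕ) : Polynomial.C (vdm p n a s) =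
    Matrix.det (Matrix.of fun i j : Fin s => Polynomial.C (var p n (a + j)) ^ p ^ (i : ℕ)) := by
  rw [vdm, RingHom.map_det]
  congr 1
  ext i j : 2
  simp

lemma map_det_of {A B ι : Type*} [CommRing A] [CommRing B] [Fintype ι] [DecidableEq ι]
    (π : B →+* A) (e : ι → ℕ) (x : ι → B) :
    π (Matrix.det (Matrix.of fun i j => x j ^ e i)) =
      Matrix.det (Matrix.of fun i j => π (x j) ^ e i) := by
  rw [RingHom.map_det]
  congr 1
  ext i j : 2
  simp

lemma X_pow_dvd_hatTotal_vdm_sub_vdmTop [Fact p.Prime] (a s : ℕ) :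
    Polynomial.X ^ K ∣
      Polynomial.X ^ pNum p s * hatTotal p n K (vdm p n a (s + 1)) - vdmTop p n K a s := by
  have hp : p.Prime := Fact.out
  obtain ⟨A, _, π, -, hπ⟩ := exists_quotient_X_pow (R := Poly p n) K
  rw [← hπ, map_sub, sub_eq_zero]
  have h (i : ℕ) (j : Fin (s + 1)) := map_hatTotal_var_pow p n K π hπ i (a + j)
  have key := pow_mul_det_updateRow_moore hp.two_le h
  rw [← det_moore_eq_updateRow h] at key
  rw [map_mul, map_pow, hatTotal_vdm, map_det_of π (fun i : Fin (s + 1) => p ^ (i : ℕ)), key,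
    vdmTop, RingHom.map_det]
  congr 1
  ext i j
  by_cases hi : i = Fin.last s
  · subst hi; simp
  · simp [Matrix.updateRow_ne hi]

/-- The first operation of positive degree in the family `(-1)^r χ(P^r)` that can act nontrivially
on a determinant of size `s + 1` has `r = p^s`. -/
lemma X_pow_dvd_hatTotal_vdm_sub_C [Fact p.Prime] {L : ℕ} (a s : ℕ) (hK : L ≤ K)
    (hL : L ≤ p ^ s) : Polynomial.X ^ L ∣
      hatTotal p n K (vdm p n a (s + 1)) - Polynomial.C (vdm p n a (s + 1)) := by
  obtain ⟨A, _, π, hsurj, hπ⟩ := exists_quotient_X_pow (R := Poly p n) K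
  have h (i : ℕ) (j : Fin (s + 1)) := map_hatTotal_var_pow p n K π hπ i (a + j)
  obtain ⟨c, hc⟩ := pow_dvd_det_moore_sub h
  obtain ⟨c, rfl⟩ := hsurj c
  have key : π (hatTotal p n K (vdm p n a (s + 1)) - Polynomial.C (vdm p n a (s + 1))) =
      π (Polynomial.X ^ p ^ s * c) := by
    rw [map_sub, hatTotal_vdm, C_vdm, map_det_of π (fun i : Fin (s + 1) => p ^ (i : ℕ)),
      map_det_of π (fun i : Fin (s + 1) => p ^ (i : ℕ)), map_mul, map_pow]
    exact hc
  rw [← sub_eq_zero, ← map_sub, hπ] at key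
  have := ((pow_dvd_pow Polynomial.X hK).trans key).add
    ((pow_dvd_pow Polynomial.X hL).mul_right c)
  simpa using this

lemma exists_vdmTop_eq (a s : ℕ) : ∃ c : Fin s → Poly p n,
    vdmTop p n K a s = Polynomial.C (vdm p n a s) * hatTotal p n K (var p n (a + s)) +
      ∑ j : Fin s, Polynomial.C (c j) * hatTotal p n K (var p n (a + j)) := by
  obtain ⟨c, hc⟩ := exists_det_updateRow_last_eq Polynomial.C
    (Matrix.of fun i j : Fin (s + 1) => var p n (a + j) ^ p ^ (i : ℕ))
    fun j => hatTotal p n K (var p n (a + j))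
  refine ⟨c, ?_⟩
  have hM : (Matrix.of fun i j : Fin (s + 1) => Polynomial.C (var p n (a + j)) ^ p ^ (i : ℕ)) =
      (Matrix.of fun i j : Fin (s + 1) => var p n (a + j) ^ p ^ (i : ℕ)).map Polynomial.C := by
    ext i j : 2
    simp
  rw [vdmTop, hM, hc]
  rfl

end HatTotalVdm

/-! ### Digit sums and the coefficient of minimal length -/

section DigitSum

/-- The sum of the base `p` digits of `m`: the least number of powers of `p` with sum `m`. -/
def digitSum (p m : ℕ) : ℕ := (Nat.digits p m).sum

lemma digitSum_zero (p : ℕ) : digitSum p 0 = 0 := by simp [digitSum]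

lemma digitSum_mul_add {p : ℕ} (hp : 2 ≤ p) (m : ℕ) {c : ℕ} (hc : c < p) :
    digitSum p (c + p * m) = c + digitSum p m := by
  by_cases h : c ≠ 0 ∨ m ≠ 0
  · rw [digitSum, Nat.digits_add p (by omega) c m hc h, List.sum_cons, digitSum]
  · push Not at h
    simp [h.1, h.2, digitSum]

lemma digitSum_pow {p : ℕ} (hp : 2 ≤ p) (e : ℕ) : digitSum p (p ^ e) = 1 := by
  induction e with
  | zero => simpa [digitSum_zero] using digitSum_mul_add hp 0 (c := 1) (by omega)
  | succ e ih => simpa [ih, pow_succ'] using digitSum_mul_add hp (p ^ e) (c := 0) (by omega)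

/-- Subadditivity of the digit sum, read off from Legendre's formula. -/
lemma digitSum_add_le {p : ℕ} [hp : Fact p.Prime] (m k : ℕ) :
    digitSum p (m + k) ≤ digitSum p m + digitSum p k := by
  have h1 := sub_one_mul_padicValNat_factorial (p := p) m
  have h2 := sub_one_mul_padicValNat_factorial (p := p) k
  have h3 := sub_one_mul_padicValNat_factorial (p := p) (m + k)
  have h4 : padicValNat p m.factorial + padicValNat p k.factorial ≤
      padicValNat p (m + k).factorial := by
    rw [← padicValNat.mul m.factorial_ne_zero k.factorial_ne_zero]
    exact padicValNat_dvd_iff_le (Nat.factorial_ne_zero _) |>.1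
      (pow_padicValNat_dvd.trans (Nat.factorial_mul_factorial_dvd_factorial_add m k))
  have h5 := Nat.mul_le_mul_left (p - 1) h4
  have h6 := Nat.digit_sum_le p m
  have h7 := Nat.digit_sum_le p k
  have h8 := Nat.digit_sum_le p (m + k)
  rw [mul_add] at h5
  unfold digitSum
  omega

/-- The exponent `(b+1)p^N - 1` has digits `p - 1` (`N` times) and `b`. -/
lemma digitSum_eq {p : ℕ} (hp : 2 ≤ p) {b : ℕ} (hb : b ≤ p - 1) (N m : ℕ)
    (hm : m + 1 = (b + 1) * p ^ N) : digitSum p m = N * (p - 1) + b := by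
  induction N generalizing m with
  | zero =>
    obtain rfl : m = b := by simpa using hm
    simpa [digitSum_zero] using digitSum_mul_add hp 0 (c := m) (by omega)
  | succ N ih =>
    obtain ⟨k, hk⟩ : ∃ k, k + 1 = (b + 1) * p ^ N :=
      ⟨(b + 1) * p ^ N - 1, Nat.sub_add_cancel (Nat.mul_pos (by omega) (pow_pos (by omega) N))⟩
    have : m = (p - 1) + p * k := by
      have : m + 1 = p * (k + 1) := by rw [hm, hk]; ring
      rw [mul_add] at this
      omega
    rw [this, digitSum_mul_add hp _ (by omega), ih k hk]
    ring

end DigitSum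

section Defect

variable {R : Type*} [CommRing R] (p : ℕ)

/-- The polynomials in `t` in which `t^T` occurs only if `(p-1)T + g` has digit sum at most `g - e`.
For `e = 0` these include the products of `g` linear combinations of the powers `t^{p_k}`, for which
`(p-1)T + g` is a sum of `g` powers of `p`; the defect `e` measures how far this sum is from being
the shortest one. -/
def defect (g e : ℕ) : Submodule R (Polynomial R) where
  carrier := {f | ∀ T, f.coeff T ≠ 0 → digitSum p ((p - 1) * T + g) + e ≤ g}
  zero_mem' := fun T h => absurd (Polynomial.coeff_zero T) h
  add_mem' := by
    intro f h hf hh T hT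
    by_cases h0 : f.coeff T = 0
    · exact hh T (by simpa [h0] using hT)
    · exact hf T h0
  smul_mem' := by
    intro c f hf T hT
    exact hf T (fun h => hT (by simp [h]))

variable {p}

lemma mul_mem_defect [Fact p.Prime] {g e g' e' : ℕ} {f f' : Polynomial R}
    (hf : f ∈ defect p g e) (hf' : f' ∈ defect p g' e') : f * f' ∈ defect p (g + g') (e + e') := by
  intro T hT
  rw [Polynomial.coeff_mul] at hT
  obtain ⟨⟨i, j⟩, hij, hne⟩ := Finset.exists_ne_zero_of_sum_ne_zero hT
  rw [Finset.HasAntidiagonal.mem_antidiagonal] at hij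
  have h1 := hf i (left_ne_zero_of_mul hne)
  have h2 := hf' j (right_ne_zero_of_mul hne)
  have h3 := digitSum_add_le (p := p) ((p - 1) * i + g) ((p - 1) * j + g')
  have h4 : (p - 1) * i + g + ((p - 1) * j + g') = (p - 1) * T + (g + g') := by
    simp only at hij
    rw [← hij]; ring
  rw [h4] at h3
  omega

lemma C_mul_mem_defect {g e : ℕ} (c : R) {f : Polynomial R} (hf : f ∈ defect p g e) :
    Polynomial.C c * f ∈ defect p g e := by
  rw [← Polynomial.smul_eq_C_mul]
  exact Submodule.smul_mem _ c hf

lemma one_mem_defect : (1 : Polynomial R) ∈ defect p 0 0 := by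
  intro T hT
  have : T = 0 := by
    by_contra h
    exact hT (by simp [Polynomial.coeff_one, h])
  simp [this, digitSum_zero]

lemma prod_mem_defect [Fact p.Prime] {ι : Type*} (s : Finset ι) (f : ι → Polynomial R)
    (hf : ∀ i ∈ s, f i ∈ defect p 1 0) : ∏ i ∈ s, f i ∈ defect p s.card 0 := by
  classical
  induction s using Finset.induction_on with
  | empty => simpa using one_mem_defect
  | insert a s ha ih =>
    rw [Finset.prod_insert ha, Finset.card_insert_of_notMem ha, add_comm]
    exact mul_mem_defect (hf a (by simp)) (ih fun i hi => hf i (by simp [hi]))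

lemma X_pow_mem_defect {g e m : ℕ} (h : digitSum p ((p - 1) * m + g) + e ≤ g) :
    (Polynomial.X ^ m : Polynomial R) ∈ defect p g e := by
  intro T hT
  have : T = m := by
    by_contra hne
    exact hT (by simp [Polynomial.coeff_X_pow, hne])
  rwa [this]

lemma hatTotal_var_mem_defect (p n K j : ℕ) [Fact p.Prime] :
    hatTotal p n K (var p n j) ∈ defect p 1 0 := by
  have hp : p.Prime := Fact.out
  rw [hatTotal_var]
  refine Submodule.sum_mem _ fun k _ => C_mul_mem_defect _ (X_pow_mem_defect ?_)
  rw [sub_one_mul_pNum hp.two_le, digitSum_pow hp.two_le]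

/-- In characteristic `p` the `p`-th power of a linear combination of the `t^{p_k}` is one of the
`t^{p p_k}`, and `(p-1) p p_k + p` is a single power of `p`. -/
lemma hatTotal_var_pow_mem_defect (p n K j : ℕ) [Fact p.Prime] :
    hatTotal p n K (var p n j) ^ p ∈ defect p p 1 := by
  have hp : p.Prime := Fact.out
  rw [hatTotal_var, sum_pow_char]
  refine Submodule.sum_mem _ fun k _ => ?_
  rw [mul_pow, ← map_pow, ← pow_mul, ← pow_mul]
  refine C_mul_mem_defect _ (X_pow_mem_defect ?_)
  have : (p - 1) * (pNum p k * p) + p = p ^ (k + 1) := by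
    rw [pow_succ, ← sub_one_mul_pNum hp.two_le k]; ring
  rw [this, digitSum_pow hp.two_le]
  exact hp.two_le

end Defect

section OneBlock

variable (p n K : ℕ) [Fact p.Prime]

lemma vdmTop_mem_defect (a s : ℕ) : vdmTop p n K a s ∈ defect p 1 0 := by
  obtain ⟨c, hc⟩ := exists_vdmTop_eq p n K a s
  rw [hc]
  exact Submodule.add_mem _ (C_mul_mem_defect _ (hatTotal_var_mem_defect p n K _))
    (Submodule.sum_mem _ fun j _ => C_mul_mem_defect _ (hatTotal_var_mem_defect p n K _))

/-- A factor belonging to a row that is already full, i.e. that occurs `p - 1` times, creates a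
`p`-th power. -/
lemma prod_mul_hatTotal_var_mem_defect {g j : ℕ} (hj : (j + 1) * (p - 1) ≤ g) :
    (∏ q ∈ Finset.range g, hatTotal p n K (var p n (q / (p - 1)))) * hatTotal p n K (var p n j) ∈
      defect p (g + 1) 1 := by
  have hp : p.Prime := Fact.out
  have hd : 0 < p - 1 := by have := hp.two_le; omega
  have hsub : Finset.Ico (j * (p - 1)) ((j + 1) * (p - 1)) ⊆ Finset.range g := by
    intro q hq
    simp only [Finset.mem_Ico, Finset.mem_range] at hq ⊢
    omega
  have hcard : (Finset.Ico (j * (p - 1)) ((j + 1) * (p - 1))).card = p - 1 := by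
    rw [Nat.card_Ico, add_mul, one_mul, Nat.add_sub_cancel_left]
  have hblock : ∏ q ∈ Finset.Ico (j * (p - 1)) ((j + 1) * (p - 1)),
      hatTotal p n K (var p n (q / (p - 1))) = hatTotal p n K (var p n j) ^ (p - 1) := by
    refine (Finset.prod_eq_pow_card (b := hatTotal p n K (var p n j)) fun q hq => ?_).trans
      (by rw [hcard])
    rw [Finset.mem_Ico] at hq
    rw [Nat.div_eq_of_lt_le hq.1 hq.2]
  rw [← Finset.prod_sdiff hsub, hblock, mul_assoc, ← pow_succ, Nat.sub_add_cancel hp.one_le]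
  have := mul_mem_defect (prod_mem_defect (p := p) (Finset.range g \
    Finset.Ico (j * (p - 1)) ((j + 1) * (p - 1))) (fun q => hatTotal p n K (var p n (q / (p - 1))))
    fun q _ => hatTotal_var_mem_defect p n K _) (hatTotal_var_pow_mem_defect p n K j)
  rw [Finset.card_sdiff_of_subset hsub, hcard, Finset.card_range] at this
  rw [add_mul, one_mul] at hj
  have h2 := hp.one_le
  convert this using 2
  omega

/-- Modulo terms of positive defect, each determinant may be replaced by its leading cofactor times
the image of its last variable. -/
lemma prod_vdmTop_sub_mem_defect (σ : ℕ → ℕ) (g : ℕ) (hσ : ∀ q < g, σ q ≤ q / (p - 1)) :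
    (∏ q ∈ Finset.range g, vdmTop p n K (q / (p - 1) - σ q) (σ q)) -
      Polynomial.C (∏ q ∈ Finset.range g, vdm p n (q / (p - 1) - σ q) (σ q)) *
        ∏ q ∈ Finset.range g, hatTotal p n K (var p n (q / (p - 1))) ∈ defect p g 1 := by
  have hp : p.Prime := Fact.out
  have hd : 0 < p - 1 := by have := hp.two_le; omega
  induction g with
  | zero => simp
  | succ g ih =>
    obtain ⟨c, hc⟩ := exists_vdmTop_eq p n K (g / (p - 1) - σ g) (σ g)
    have hg := hσ g (by omega)
    rw [Nat.sub_add_cancel hg] at hc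
    have h1 := mul_mem_defect (ih fun q hq => hσ q (by omega))
      (vdmTop_mem_defect p n K (g / (p - 1) - σ g) (σ g))
    -- The other variables of the `g`-th determinant belong to earlier rows, which are full.
    have h2 : Polynomial.C (∏ q ∈ Finset.range g, vdm p n (q / (p - 1) - σ q) (σ q)) *
        ∑ j : Fin (σ g), Polynomial.C (c j) *
          ((∏ q ∈ Finset.range g, hatTotal p n K (var p n (q / (p - 1)))) *
            hatTotal p n K (var p n (g / (p - 1) - σ g + j))) ∈ defect p (g + 1) 1 := by
      refine C_mul_mem_defect _ (Submodule.sum_mem _ fun j _ => C_mul_mem_defect _ ?_)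
      refine prod_mul_hatTotal_var_mem_defect p n K ?_
      refine (Nat.mul_le_mul_right (p - 1) ?_).trans (Nat.div_mul_le_self g (p - 1))
      omega
    convert Submodule.add_mem _ h1 h2 using 1
    rw [Finset.prod_range_succ, Finset.prod_range_succ, Finset.prod_range_succ, hc, map_mul]
    have h3 : ∀ y : Polynomial (Poly p n), ∑ j : Fin (σ g), Polynomial.C (c j) *
          (y * hatTotal p n K (var p n (g / (p - 1) - σ g + j))) =
        y * ∑ j : Fin (σ g), Polynomial.C (c j) *
          hatTotal p n K (var p n (g / (p - 1) - σ g + j)) := by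
      intro y
      rw [Finset.mul_sum]
      exact Finset.sum_congr rfl fun j _ => mul_left_comm _ _ _
    rw [h3]
    ring

lemma X_pow_dvd_prod_sub_prod (σ a : ℕ → ℕ) (g : ℕ) :
    Polynomial.X ^ K ∣ Polynomial.X ^ (∑ q ∈ Finset.range g, pNum p (σ q)) *
        hatTotal p n K (∏ q ∈ Finset.range g, vdm p n (a q) (σ q + 1)) -
      ∏ q ∈ Finset.range g, vdmTop p n K (a q) (σ q) := by
  obtain ⟨A, _, π, -, hπ⟩ := exists_quotient_X_pow (R := Poly p n) K
  rw [← hπ, map_sub, sub_eq_zero, map_prod, map_prod, map_mul, map_prod, map_pow,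
    ← Finset.prod_pow_eq_pow_sum, ← Finset.prod_mul_distrib]
  refine Finset.prod_congr rfl fun q _ => ?_
  rw [← map_pow, ← map_mul, ← sub_eq_zero, ← map_sub, hπ]
  exact X_pow_dvd_hatTotal_vdm_sub_vdmTop p n K _ _

/-- The operation of the degree singled out by `T` strips the last variable from every determinant
in the product, up to a factor that does not depend on the sizes `σ q + 1` of the determinants. -/
lemma hatP_prod_vdm_eq (hp2 : p ≠ 2) {N b T r : ℕ} (hb : b ≤ p - 1)
    (hT : (p - 1) * T + (N * (p - 1) + b) + 1 = (b + 1) * p ^ N) (hK : T < K) (σ : ℕ → ℕ)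
    (hσ : ∀ q < N * (p - 1) + b, σ q ≤ q / (p - 1))
    (hr : r + ∑ q ∈ Finset.range (N * (p - 1) + b), pNum p (σ q) = T) :
    hatP p n r (∏ q ∈ Finset.range (N * (p - 1) + b), vdm p n (q / (p - 1) - σ q) (σ q + 1)) =
      (∏ q ∈ Finset.range (N * (p - 1) + b), vdm p n (q / (p - 1) - σ q) (σ q)) *
        (∏ q ∈ Finset.range (N * (p - 1) + b),
          hatTotal p n K (var p n (q / (p - 1)))).coeff T := by
  have hp : p.Prime := Fact.out
  set G := N * (p - 1) + b with hG
  have h1 := Polynomial.X_pow_dvd_iff.1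
    (X_pow_dvd_prod_sub_prod p n K σ (fun q => q / (p - 1) - σ q) G) T hK
  rw [Polynomial.coeff_sub, sub_eq_zero, ← hr, add_comm r, add_comm (∑ q ∈ _, _),
    Polynomial.coeff_X_pow_mul, coeff_hatTotal p n K r hp2 (by omega), hr] at h1
  rw [h1, ← Polynomial.coeff_C_mul, ← sub_eq_zero, ← Polynomial.coeff_sub]
  by_contra hne
  have h2 := prod_vdmTop_sub_mem_defect p n K σ G hσ T hne
  rw [digitSum_eq hp.two_le hb N _ hT] at h2
  omega

end OneBlock

/-! ### The factor split off by one operation -/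

section FirstBlock

lemma prod_range_div {M : Type*} [CommMonoid M] {d : ℕ} (hd : 0 < d) (f : ℕ → M) (N : ℕ) {b : ℕ}
    (hb : b ≤ d) : ∏ q ∈ Finset.range (N * d + b), f (q / d) =
      (∏ i ∈ Finset.range N, f i) ^ d * f N ^ b := by
  have key : ∀ (N : ℕ) {b : ℕ}, b ≤ d → ∏ q ∈ Finset.range (N * d + b), f (q / d) =
      (∏ q ∈ Finset.range (N * d), f (q / d)) * f N ^ b := by
    intro N b hb
    rw [Finset.prod_range_add]
    congr 1
    refine (Finset.prod_eq_pow_card (b := f N) fun x hx => ?_).trans (by rw [Finset.card_range])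
    rw [Finset.mem_range] at hx
    rw [Nat.mul_comm, Nat.mul_add_div hd, Nat.div_eq_of_lt (by omega), add_zero]
  have full : ∀ N, ∏ q ∈ Finset.range (N * d), f (q / d) = (∏ i ∈ Finset.range N, f i) ^ d := by
    intro N
    induction N with
    | zero => simp
    | succ N ih => rw [add_mul, one_mul, key N le_rfl, ih, Finset.prod_range_succ, mul_pow]
  rw [key N hb, full]

variable (p n : ℕ)

lemma vdm_zero (a : ℕ) : vdm p n a 0 = 1 := Matrix.det_isEmpty

lemma w_zero : w p n 0 = 1 := vdm_zero p n 0

lemma hatP_zero (f : Poly p n) : hatP p n 0 f = f := by simp [hatP, chiP]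

variable [Fact p.Prime]

/-- The monomials in the Leibniz expansion of `w(k)` are distinct. -/
lemma w_ne_zero {k : ℕ} (hk : k ≤ n) : w p n k ≠ 0 := by
  have hp : p.Prime := Fact.out
  intro h0
  let ι : Fin k → Fin n := Fin.castLE hk
  have hι : Function.Injective ι := Fin.castLE_injective hk
  let e : Equiv.Perm (Fin k) → (Fin n →₀ ℕ) := fun τ =>
    ∑ i, Finsupp.single (ι i) (p ^ (τ i : ℕ))
  have he : ∀ τ i, e τ (ι i) = p ^ (τ i : ℕ) := by
    intro τ i
    rw [Finsupp.finsetSum_apply, Finset.sum_eq_single i]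
    · simp
    · intro j _ hj
      exact Finsupp.single_eq_of_ne (fun hc => hj (hι hc).symm)
    · simp
  have hdet : w p n k = ∑ τ : Equiv.Perm (Fin k),
      (Equiv.Perm.sign τ : ℤ) • monomial (e τ) (1 : ZMod p) := by
    rw [w, vdm, Matrix.det_apply]
    refine Finset.sum_congr rfl fun τ _ => ?_
    rw [Units.smul_def]
    congr 1
    refine Eq.trans ?_ (MvPolynomial.monomial_sum_one Finset.univ fun i =>
      Finsupp.single (ι i) (p ^ (τ i : ℕ))).symm
    refine Finset.prod_congr rfl fun i _ => ?_
    have hi : (0 + (i : ℕ)) < n := by omega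
    rw [Matrix.of_apply, var, dif_pos hi, X_pow_eq_monomial]
    congr 2
    ext; simp [ι]; rfl
  have hc := congrArg (coeff (e 1)) h0
  rw [hdet, coeff_sum, Finset.sum_eq_single 1, coeff_zero] at hc
  · simp at hc
  · intro τ _ hτ
    rw [coeff_smul, coeff_monomial, if_neg, smul_zero]
    intro hc
    refine hτ (Equiv.ext fun i => Fin.ext ?_)
    have := he τ i
    rw [hc, he] at this
    exact (Nat.pow_right_injective hp.two_le this).symm
  · simp

lemma sum_pNum_div {N b : ℕ} (hb : b ≤ p - 1) :
    (p - 1) * ∑ q ∈ Finset.range (N * (p - 1) + b), pNum p (q / (p - 1)) +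
      (N * (p - 1) + b) + 1 = (b + 1) * p ^ N := by
  have hp : p.Prime := Fact.out
  have hd : 0 < p - 1 := by have := hp.two_le; omega
  have h := prod_range_div (M := Multiplicative ℕ) hd (fun i => Multiplicative.ofAdd (p ^ i)) N hb
  apply_fun Multiplicative.toAdd at h
  simp only [toAdd_mul, toAdd_pow, toAdd_prod, toAdd_ofAdd, smul_eq_mul] at h
  rw [← pNum_eq_sum hp.two_le] at h
  have h2 : ∑ q ∈ Finset.range (N * (p - 1) + b), p ^ (q / (p - 1)) =
      (p - 1) * ∑ q ∈ Finset.range (N * (p - 1) + b), pNum p (q / (p - 1)) +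
      (N * (p - 1) + b) := by
    simp only [← sub_one_mul_pNum hp.two_le]
    rw [Finset.sum_add_distrib, Finset.mul_sum, Finset.sum_const, Finset.card_range, smul_eq_mul,
      mul_one]
  rw [← h2, h, add_right_comm, sub_one_mul_pNum hp.two_le]
  ring

/-- The factor in `hatP_prod_vdm_eq` is found by taking determinants of the largest size: then
`r = 0`, and the identity expresses `∏ w(q/(p-1) + 1)` through `∏ w(q/(p-1))`. -/
lemma coeff_prod_hatTotal_var (hp2 : p ≠ 2) {N b T : ℕ} (hb : b ≤ p - 1) (hN : N ≤ n)
    (hT : (p - 1) * T + (N * (p - 1) + b) + 1 = (b + 1) * p ^ N) :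
    (∏ q ∈ Finset.range (N * (p - 1) + b),
      hatTotal p n (T + 1) (var p n (q / (p - 1)))).coeff T =
      w p n (N + 1) ^ b * w p n N ^ (p - 1 - b) := by
  have hp : p.Prime := Fact.out
  have hd : 0 < p - 1 := by have := hp.two_le; omega
  have hsum : 0 + ∑ q ∈ Finset.range (N * (p - 1) + b), pNum p (q / (p - 1)) = T := by
    have h := sum_pNum_div p (N := N) hb
    rw [zero_add]
    refine Nat.eq_of_mul_eq_mul_left hd ?_
    omega
  have h := hatP_prod_vdm_eq p n (T + 1) hp2 hb hT (Nat.lt_succ_self T) (fun q => q / (p - 1))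
    (fun q _ => le_rfl) hsum
  simp only [Nat.sub_self, hatP_zero] at h
  change ∏ q ∈ _, w p n (q / (p - 1) + 1) = (∏ q ∈ _, w p n (q / (p - 1))) * _ at h
  rw [prod_range_div hd (fun i => w p n (i + 1)) N hb,
    prod_range_div hd (fun i => w p n i) N hb] at h
  have h1 : ∏ i ∈ Finset.range N, w p n (i + 1) =
      (∏ i ∈ Finset.range N, w p n i) * w p n N := by
    have := Finset.prod_range_succ' (fun i => w p n i) N
    rw [w_zero, mul_one] at this
    rw [← this, Finset.prod_range_succ]
  have h2 : (∏ i ∈ Finset.range N, w p n i) ^ (p - 1) * w p n N ^ b ≠ 0 := by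
    refine mul_ne_zero (pow_ne_zero _ (Finset.prod_ne_zero_iff.2 fun i hi => ?_))
      (pow_ne_zero _ (w_ne_zero p n hN))
    rw [Finset.mem_range] at hi
    exact w_ne_zero p n (by omega)
  -- `∏ w(i + 1) = w(N) ∏ w(i)` over `i < N`, so that the rest is cancellation in a domain.
  refine mul_left_cancel₀ h2 ?_
  rw [← h, h1, mul_pow]
  nth_rw 2 [← Nat.sub_add_cancel hb]
  rw [pow_add]
  ring

lemma hatP_prod_vdm (hp2 : p ≠ 2) {N b T r : ℕ} (hb : b ≤ p - 1) (hN : N ≤ n)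
    (hT : (p - 1) * T + (N * (p - 1) + b) + 1 = (b + 1) * p ^ N) (σ : ℕ → ℕ)
    (hσ : ∀ q < N * (p - 1) + b, σ q ≤ q / (p - 1))
    (hr : r + ∑ q ∈ Finset.range (N * (p - 1) + b), pNum p (σ q) = T) :
    hatP p n r (∏ q ∈ Finset.range (N * (p - 1) + b), vdm p n (q / (p - 1) - σ q) (σ q + 1)) =
      (∏ q ∈ Finset.range (N * (p - 1) + b), vdm p n (q / (p - 1) - σ q) (σ q)) *
        (w p n (N + 1) ^ b * w p n N ^ (p - 1 - b)) := by
  rw [hatP_prod_vdm_eq p n (T + 1) hp2 hb hT (Nat.lt_succ_self T) σ hσ hr,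
    coeff_prod_hatTotal_var p n hp2 hb hN hT]

end FirstBlock

section HatConst

/-- `f` behaves as a constant for the operations `(-1)^r χ(P^r)` with `r < L`. -/
def HatConstBelow (p n L : ℕ) (f : Poly p n) : Prop :=
  Polynomial.X ^ L ∣ hatTotal p n L f - Polynomial.C f

variable {p n : ℕ}

lemma HatConstBelow.mul {L : ℕ} {f g : Poly p n} (hf : HatConstBelow p n L f)
    (hg : HatConstBelow p n L g) : HatConstBelow p n L (f * g) := by
  rw [HatConstBelow, map_mul, map_mul]
  exact dvd_mul_sub_mul hf hg

lemma HatConstBelow.pow {L : ℕ} {f : Poly p n} (hf : HatConstBelow p n L f) (k : ℕ) :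
    HatConstBelow p n L (f ^ k) := by
  induction k with
  | zero => simp [HatConstBelow]
  | succ k ih => rw [pow_succ]; exact ih.mul hf

variable [Fact p.Prime]

lemma hatConstBelow_w {L s : ℕ} (hL : L ≤ p ^ s) : HatConstBelow p n L (w p n (s + 1)) :=
  X_pow_dvd_hatTotal_vdm_sub_C p n L 0 s le_rfl hL

lemma hatP_mul_of_hatConstBelow (hp2 : p ≠ 2) {L r : ℕ} {g : Poly p n}
    (hg : HatConstBelow p n L g) (hr : r < L) (f : Poly p n) :
    hatP p n r (f * g) = hatP p n r f * g := by
  have h : Polynomial.X ^ L ∣ hatTotal p n L (f * g) - hatTotal p n L f * Polynomial.C g := by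
    rw [map_mul, ← mul_sub]
    exact Dvd.dvd.mul_left hg _
  have h2 := Polynomial.X_pow_dvd_iff.1 h r hr
  rwa [Polynomial.coeff_sub, sub_eq_zero, Polynomial.coeff_mul_C,
    coeff_hatTotal p n L r hp2 hr, coeff_hatTotal p n L r hp2 hr] at h2

end HatConst

/-! ### Diagrams and their first block of columns -/

section Diagram

/-- The diagram obtained by removing the first `d` columns. -/
def dropCols (d : ℕ) (lam : YoungDiagram) : YoungDiagram where
  cells := (lam.cells.filter fun c => d ≤ c.2).image fun c => (c.1, c.2 - d)
  isLowerSet := by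
    rintro ⟨i, j⟩ ⟨i', j'⟩ ⟨hi, hj⟩ h
    simp only at hi hj
    simp only [Finset.coe_image, Set.mem_image, Finset.mem_coe, Finset.mem_filter,
      YoungDiagram.mem_cells, Prod.mk.injEq, Prod.exists] at h ⊢
    obtain ⟨x, y, ⟨hxy, hd⟩, rfl, rfl⟩ := h
    exact ⟨i', j' + d, ⟨lam.up_left_mem hi (by omega) hxy, by omega⟩, rfl, by omega⟩

lemma mem_dropCols {d : ℕ} {lam : YoungDiagram} {i j : ℕ} :
    (i, j) ∈ dropCols d lam ↔ (i, j + d) ∈ lam := by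
  rw [← YoungDiagram.mem_cells, dropCols]
  simp only [Finset.mem_image, Finset.mem_filter, YoungDiagram.mem_cells, Prod.mk.injEq,
    Prod.exists]
  constructor
  · rintro ⟨x, y, ⟨h, hd⟩, rfl, rfl⟩
    rwa [Nat.sub_add_cancel hd]
  · intro h
    exact ⟨i, j + d, ⟨h, by omega⟩, rfl, by omega⟩

lemma rowLen_dropCols (d : ℕ) (lam : YoungDiagram) (i : ℕ) :
    (dropCols d lam).rowLen i = lam.rowLen i - d := by
  refine eq_of_forall_lt_iff fun j => ?_
  rw [← YoungDiagram.mem_iff_lt_rowLen, mem_dropCols, YoungDiagram.mem_iff_lt_rowLen]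
  omega

lemma colLen_dropCols (d : ℕ) (lam : YoungDiagram) (j : ℕ) :
    (dropCols d lam).colLen j = lam.colLen (j + d) := by
  refine eq_of_forall_lt_iff fun i => ?_
  rw [← YoungDiagram.mem_iff_lt_colLen, mem_dropCols, YoungDiagram.mem_iff_lt_colLen]

lemma TRegular.dropCols {p : ℕ} {lam : YoungDiagram} (h : TRegular p lam) :
    TRegular p (dropCols (p - 1) lam) := by
  refine ⟨fun i => ?_, fun a ha i i' hi hi' => ?_⟩
  · have := h.1 i
    rw [rowLen_dropCols, rowLen_dropCols]
    omega
  · rw [rowLen_dropCols] at hi hi'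
    obtain ⟨a, rfl⟩ : ∃ c, a = c + 1 := ⟨a - 1, by omega⟩
    simp only [Nat.add_sub_cancel, add_mul, one_mul] at hi hi'
    refine h.2 (a + 2) (by omega) i i' ?_ ?_ <;>
    · simp only [add_mul, one_mul,
        show a + 2 - 1 = a + 1 from rfl, show 2 * (p - 1) = (p - 1) + (p - 1) from two_mul _]
      omega

lemma rowLen_le_add {p : ℕ} {lam : YoungDiagram} (h : ColumnRegular p lam) (i k : ℕ) :
    lam.rowLen i ≤ lam.rowLen (i + k) + k * (p - 1) := by
  induction k with
  | zero => simp
  | succ k ih =>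
    have := h (i + k)
    rw [add_mul, one_mul, ← add_assoc i]
    omega

/-- A finite lower set of natural numbers is an initial segment. -/
lemma eq_range_card_of_lower {S : Finset ℕ} (h : ∀ x ∈ S, ∀ y ≤ x, y ∈ S) :
    S = Finset.range S.card := by
  refine Finset.eq_of_subset_of_card_le (fun x hx => ?_) (by simp)
  have : Finset.range (x + 1) ⊆ S := fun y hy => h x hx y (by simp at hy; omega)
  have := Finset.card_le_card this
  rw [Finset.card_range] at this
  rw [Finset.mem_range]
  omega

variable {p : ℕ} {lam : YoungDiagram}

/-- In a `T`-regular diagram, at most one row meets the first `p - 1` columns partially, so that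
these columns are filled row by row: the boxes in them are the first `γ_1` ones. -/
lemma lt_tConj_one_iff (hp : 2 ≤ p) (h : TRegular p lam) (q : ℕ) :
    q < tConj p lam 1 ↔ q % (p - 1) < lam.rowLen (q / (p - 1)) := by
  have hd : 0 < p - 1 := by omega
  set d := p - 1 with hdd
  set B := lam.cells.filter fun c => (1 - 1) * d ≤ c.2 ∧ c.2 < 1 * d with hB
  have hmem : ∀ q, q ∈ B.image (fun c => c.1 * d + c.2) ↔ q % d < lam.rowLen (q / d) := by
    intro q
    simp only [hB, Finset.mem_image, Finset.mem_filter, YoungDiagram.mem_cells, Prod.exists,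
      Nat.sub_self, zero_mul, one_mul, zero_le, true_and]
    constructor
    · rintro ⟨i, j, ⟨hij, hj⟩, rfl⟩
      rw [mul_comm, Nat.mul_add_mod, Nat.mod_eq_of_lt hj, Nat.mul_add_div hd, Nat.div_eq_of_lt hj,
        add_zero]
      exact YoungDiagram.mem_iff_lt_rowLen.1 hij
    · intro hq
      exact ⟨q / d, q % d, ⟨YoungDiagram.mem_iff_lt_rowLen.2 hq, Nat.mod_lt _ hd⟩,
        Nat.div_add_mod' q d⟩
  have hcard : (B.image fun c => c.1 * d + c.2).card = tConj p lam 1 := by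
    rw [Finset.card_image_of_injOn]
    · rfl
    · rintro ⟨i, j⟩ hij ⟨i', j'⟩ hij' heq
      simp only [hB, Finset.coe_filter, Set.mem_ofPred_eq, one_mul] at hij hij' heq
      have h1 := congrArg (· / d) heq
      simp only [mul_comm _ d, Nat.mul_add_div hd, Nat.div_eq_of_lt hij.2.2,
        Nat.div_eq_of_lt hij'.2.2, add_zero] at h1
      subst h1
      simpa using heq
  have hlower : ∀ x ∈ B.image (fun c => c.1 * d + c.2), ∀ y ≤ x,
      y ∈ B.image (fun c => c.1 * d + c.2) := by
    intro x hx y hyx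
    rw [hmem] at hx ⊢
    have hdiv : y / d ≤ x / d := Nat.div_le_div_right hyx
    have hanti := lam.rowLen_anti _ _ hdiv
    have hmod := Nat.mod_lt y hd
    rcases hdiv.eq_or_lt with heq | hlt
    · have h1 := Nat.div_add_mod y d
      have h2 := Nat.div_add_mod x d
      rw [heq] at h1 ⊢
      omega
    · by_contra hcon
      exact hlt.ne (h.2 1 le_rfl _ _ (by simp only [Nat.sub_self, zero_mul, one_mul]; omega)
        (by simp only [Nat.sub_self, zero_mul, one_mul]; omega))
  rw [← hcard, ← hmem, ← Finset.mem_range, ← eq_range_card_of_lower hlower]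

lemma tConj_dropCols {k : ℕ} (hk : 1 ≤ k) :
    tConj p (dropCols (p - 1) lam) k = tConj p lam (k + 1) := by
  obtain ⟨k, rfl⟩ : ∃ c, k = c + 1 := ⟨k - 1, by omega⟩
  refine Finset.card_bij' (fun c _ => (c.1, c.2 + (p - 1))) (fun c _ => (c.1, c.2 - (p - 1)))
    ?_ ?_ ?_ ?_
  · rintro ⟨i, j⟩ h
    simp only [Finset.mem_filter, YoungDiagram.mem_cells, mem_dropCols, Nat.add_sub_cancel,
      add_mul, one_mul] at h ⊢
    exact ⟨h.1, by omega, by omega⟩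
  · rintro ⟨i, j⟩ h
    simp only [Finset.mem_filter, YoungDiagram.mem_cells, mem_dropCols, Nat.add_sub_cancel,
      add_mul, one_mul] at h ⊢
    rw [Nat.sub_add_cancel (by omega)]
    exact ⟨h.1, by omega, by omega⟩
  · rintro ⟨i, j⟩ h
    simp
  · rintro ⟨i, j⟩ h
    simp only [Finset.mem_filter, YoungDiagram.mem_cells, Nat.add_sub_cancel,
      add_mul, one_mul] at h
    simp only [Prod.mk.injEq, true_and]
    omega

lemma tConj_succ_add_le (hp : 2 ≤ p) (h : TRegular p lam) {k : ℕ} (hk : 1 ≤ k)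
    (hne : tConj p lam (k + 1) ≠ 0) : tConj p lam (k + 1) + (p - 1) ≤ tConj p lam k := by
  induction k, hk using Nat.le_induction generalizing lam with
  | base =>
    rw [← tConj_dropCols le_rfl] at hne ⊢
    have h1 := (lt_tConj_one_iff hp h.dropCols (tConj p (dropCols (p - 1) lam) 1 - 1)).1 (by omega)
    rw [rowLen_dropCols] at h1
    have h2 := h.1 ((tConj p (dropCols (p - 1) lam) 1 - 1) / (p - 1))
    have h3 := (lt_tConj_one_iff hp h (tConj p (dropCols (p - 1) lam) 1 - 1 + (p - 1))).2 (by
      rw [Nat.add_mod_right, Nat.add_div_right _ (by omega)]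
      omega)
    omega
  | succ k hk ih =>
    have h1 := tConj_dropCols (p := p) (lam := lam) (k := k + 1) (by omega)
    have h2 := tConj_dropCols (p := p) (lam := lam) hk
    rw [← h1] at hne ⊢
    rw [← h2]
    exact ih h.dropCols hne

lemma tConj_succ_le (hp : 2 ≤ p) (h : TRegular p lam) {k : ℕ} (hk : 1 ≤ k) :
    tConj p lam (k + 1) ≤ tConj p lam k := by
  by_cases hne : tConj p lam (k + 1) = 0
  · omega
  · have := tConj_succ_add_le hp h hk hne
    omega

lemma tConj_add_le (hp : 2 ≤ p) (h : TRegular p lam) {k : ℕ} (hk : 2 ≤ k)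
    (hne : tConj p lam k ≠ 0) : tConj p lam k + (p - 1) ≤ tConj p lam 1 := by
  have h2 : tConj p lam k ≤ tConj p lam 2 := by
    clear hne
    induction k, hk using Nat.le_induction with
    | base => exact le_rfl
    | succ k hk ih => exact (tConj_succ_le hp h (by omega)).trans ih
  have := tConj_succ_add_le hp h le_rfl (show tConj p lam (1 + 1) ≠ 0 by
    rw [show 1 + 1 = 2 from rfl]; omega)
  rw [show 1 + 1 = 2 from rfl] at this
  omega

lemma tConjLength_dropCols (hp : 2 ≤ p) :
    tConjLength p (dropCols (p - 1) lam) = tConjLength p lam - 1 := by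
  rw [tConjLength, tConjLength, rowLen_dropCols, Nat.ceilDiv_eq_add_pred_div,
    Nat.ceilDiv_eq_add_pred_div]
  by_cases h : p - 1 ≤ lam.rowLen 0
  · obtain ⟨x, hx⟩ := Nat.exists_eq_add_of_le h
    rw [hx, Nat.add_sub_cancel_left, show p - 1 + x + (p - 1) - 1 = x + (p - 1) - 1 + (p - 1) by omega,
      Nat.add_div_right _ (by omega)]
    rfl
  · have h0 : (lam.rowLen 0 - (p - 1) + (p - 1) - 1) / (p - 1) = 0 := Nat.div_eq_of_lt (by omega)
    have : (lam.rowLen 0 + (p - 1) - 1) / (p - 1) < 2 := by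
      rw [Nat.div_lt_iff_lt_mul (by omega)]
      omega
    omega

lemma tConj_one_eq_zero (hp : 2 ≤ p) (h : TRegular p lam) (hm : tConjLength p lam = 0) :
    tConj p lam 1 = 0 := by
  by_contra hne
  have h1 := (lt_tConj_one_iff hp h 0).1 (by omega)
  rw [tConjLength, Nat.ceilDiv_eq_add_pred_div, Nat.div_eq_zero_iff] at hm
  simp at h1
  omega

/-- The number of boxes of the `(q+1)`-st antidiagonal outside the first `p - 1` columns. -/
def tailCard (p : ℕ) (lam : YoungDiagram) (q : ℕ) : ℕ :=
  ((antidiag p lam (q + 1)).filter fun c => p - 1 ≤ c.2).card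

lemma mem_antidiag_succ {q : ℕ} {c : ℕ × ℕ} :
    c ∈ antidiag p lam (q + 1) ↔ c ∈ lam ∧ c.1 * (p - 1) + c.2 = q := by
  rw [antidiag, Finset.mem_filter, YoungDiagram.mem_cells, add_mul, one_mul]
  refine and_congr_right fun _ => ?_
  omega

lemma fst_eq_div_sub {d q : ℕ} (hd : 0 < d) {c : ℕ × ℕ} (h : c.1 * d + c.2 = q) :
    c.1 + c.2 / d = q / d ∧ c.2 % d = q % d := by
  subst h
  rw [mul_comm, Nat.mul_add_div hd, Nat.mul_add_mod]
  exact ⟨rfl, rfl⟩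

lemma tailCard_le (hp : 2 ≤ p) (q : ℕ) : tailCard p lam q ≤ q / (p - 1) := by
  have hd : 0 < p - 1 := by omega
  rw [← Finset.card_range (q / (p - 1))]
  refine Finset.card_le_card_of_injOn Prod.fst ?_ ?_
  · intro c hc
    simp only [Finset.coe_filter, mem_antidiag_succ, Set.mem_ofPred_eq] at hc
    have h1 := fst_eq_div_sub hd hc.1.2
    have h2 := Nat.div_pos hc.2 hd
    simp only [Finset.coe_range, Set.mem_Iio]
    omega
  · rintro ⟨i, j⟩ hc ⟨i', j'⟩ hc' (rfl : i = i')
    simp only [Finset.coe_filter, mem_antidiag_succ, Set.mem_ofPred_eq] at hc hc'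
    simp only [Prod.mk.injEq, true_and]
    omega

lemma div_mod_mem_antidiag (hp : 2 ≤ p) (h : TRegular p lam) {q : ℕ} (hq : q < tConj p lam 1) :
    (q / (p - 1), q % (p - 1)) ∈ antidiag p lam (q + 1) :=
  mem_antidiag_succ.2 ⟨YoungDiagram.mem_iff_lt_rowLen.2 ((lt_tConj_one_iff hp h q).1 hq),
    Nat.div_add_mod' q _⟩

/-- For `q < γ_1`, exactly one box of the antidiagonal lies in the first `p - 1` columns. -/
lemma card_antidiag_succ (hp : 2 ≤ p) (h : TRegular p lam) {q : ℕ} (hq : q < tConj p lam 1) :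
    (antidiag p lam (q + 1)).card = tailCard p lam q + 1 := by
  have hd : 0 < p - 1 := by omega
  rw [← Finset.card_filter_add_card_filter_not (s := antidiag p lam (q + 1))
    (fun c => p - 1 ≤ c.2), tailCard]
  congr 1
  rw [Finset.card_eq_one]
  refine ⟨(q / (p - 1), q % (p - 1)), Finset.ext fun c => ?_⟩
  rw [Finset.mem_filter, Finset.mem_singleton]
  constructor
  · rintro ⟨hc, hlt⟩
    have h1 := fst_eq_div_sub hd (mem_antidiag_succ.1 hc).2
    rw [Nat.div_eq_of_lt (by omega), Nat.mod_eq_of_lt (by omega)] at h1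
    exact Prod.ext h1.1 h1.2
  · rintro rfl
    exact ⟨div_mod_mem_antidiag hp h hq, not_le.2 (Nat.mod_lt _ hd)⟩

/-- Antidiagonals beyond the `γ_1`-st are empty: by column regularity an antidiagonal reaches
down to the first `p - 1` columns. -/
lemma card_antidiag_succ_eq_zero (hp : 2 ≤ p) (h : TRegular p lam) {q : ℕ}
    (hq : tConj p lam 1 ≤ q) : (antidiag p lam (q + 1)).card = 0 := by
  have hd : 0 < p - 1 := by omega
  rw [Finset.card_eq_zero, Finset.eq_empty_iff_forall_notMem]
  rintro ⟨i, j⟩ hc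
  rw [mem_antidiag_succ, YoungDiagram.mem_iff_lt_rowLen] at hc
  refine hq.not_gt ((lt_tConj_one_iff hp h q).2 ?_)
  obtain ⟨h1, h2⟩ := fst_eq_div_sub hd hc.2
  have h3 := rowLen_le_add h.1 i (j / (p - 1))
  have h4 := Nat.div_add_mod' j (p - 1)
  rw [← h2, ← h1]
  simp only at h3 h4 hc ⊢
  omega

lemma vPart_succ (hp : 2 ≤ p) (n : ℕ) (h : TRegular p lam) {q : ℕ} (hq : q < tConj p lam 1) :
    vPart p n lam (q + 1) =
      vdm p n (q / (p - 1) - tailCard p lam q) (tailCard p lam q + 1) := by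
  have hsup : (antidiag p lam (q + 1)).sup Prod.fst = q / (p - 1) := by
    refine le_antisymm (Finset.sup_le fun c hc => ?_)
      (Finset.le_sup (f := Prod.fst) (div_mod_mem_antidiag hp h hq))
    rw [← (fst_eq_div_sub (by omega) (mem_antidiag_succ.1 hc).2).1]
    exact Nat.le_add_right _ _
  rw [vPart, card_antidiag_succ hp h hq, hsup, Nat.add_sub_add_right]

lemma v_eq_prod (hp : 2 ≤ p) (n : ℕ) (h : TRegular p lam) :
    v p n lam = ∏ q ∈ Finset.range (tConj p lam 1),
      vdm p n (q / (p - 1) - tailCard p lam q) (tailCard p lam q + 1) := by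
  rw [v, ← Finset.prod_congr rfl fun q hq => vPart_succ hp n h (Finset.mem_range.1 hq),
    Finset.range_eq_Ico, Finset.prod_Ico_add' (fun k => vPart p n lam k) 0 _ 1, zero_add]
  rfl

lemma tailCard_of_lt {q : ℕ} (hq : q < p - 1) : tailCard p lam q = 0 := by
  rw [tailCard, Finset.card_eq_zero, Finset.filter_eq_empty_iff]
  intro c hc
  have := (mem_antidiag_succ.1 hc).2
  omega

lemma tailCard_add (q : ℕ) : tailCard p lam (q + (p - 1)) =
    (antidiag p (dropCols (p - 1) lam) (q + 1)).card := by
  refine Finset.card_bij' (fun c _ => (c.1, c.2 - (p - 1))) (fun c _ => (c.1, c.2 + (p - 1)))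
    ?_ ?_ ?_ ?_
  · rintro ⟨i, j⟩ hc
    simp only [Finset.mem_filter, mem_antidiag_succ, mem_dropCols] at hc ⊢
    rw [Nat.sub_add_cancel hc.2]
    exact ⟨hc.1.1, by omega⟩
  · rintro ⟨i, j⟩ hc
    simp only [Finset.mem_filter, mem_antidiag_succ, mem_dropCols] at hc ⊢
    exact ⟨⟨hc.1, by omega⟩, by omega⟩
  · rintro ⟨i, j⟩ hc
    simp only [Finset.mem_filter] at hc
    simp only [Prod.mk.injEq, true_and]
    omega
  · rintro ⟨i, j⟩ hc
    simp

end Diagram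

/-! ### Peeling off one block of columns -/

section Peeling

variable {p : ℕ} {lam : YoungDiagram}

/-- Reindexing a product over the antidiagonals of `λ` by those of the diagram with the first
`p - 1` columns removed; antidiagonals with a single box do not contribute. -/
@[to_additive]
lemma prod_tailCard {M : Type*} [CommMonoid M] (hp : 2 ≤ p) (h : TRegular p lam)
    (F : ℕ → ℕ → M) (hF : ∀ q, F q 0 = 1) :
    ∏ q ∈ Finset.range (tConj p lam 1), F q (tailCard p lam q) =
      ∏ q ∈ Finset.range (tConj p (dropCols (p - 1) lam) 1),
        F (q + (p - 1)) (tailCard p (dropCols (p - 1) lam) q + 1) := by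
  have hle : Finset.Ico (p - 1) (tConj p (dropCols (p - 1) lam) 1 + (p - 1)) ⊆
      Finset.range (tConj p lam 1) := by
    intro q hq
    rw [Finset.mem_Ico] at hq
    rw [tConj_dropCols le_rfl] at hq
    have := tConj_succ_add_le hp h le_rfl (by omega)
    rw [Finset.mem_range]
    omega
  rw [← Finset.prod_subset hle]
  · have hshift := Finset.prod_Ico_add' (fun q => F q (tailCard p lam q)) 0
      (tConj p (dropCols (p - 1) lam) 1) (p - 1)
    rw [zero_add] at hshift
    rw [Finset.range_eq_Ico, ← hshift]
    refine Finset.prod_congr rfl fun q hq => ?_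
    rw [tailCard_add, card_antidiag_succ hp h.dropCols (Finset.mem_Ico.1 hq).2]
  · intro q _ hq
    rw [Finset.mem_Ico] at hq
    by_cases hlt : q < p - 1
    · rw [tailCard_of_lt hlt, hF]
    · obtain ⟨q, rfl⟩ := Nat.exists_eq_add_of_le' (not_lt.1 hlt)
      rw [tailCard_add, card_antidiag_succ_eq_zero hp h.dropCols (by omega), hF]

lemma v_dropCols (hp : 2 ≤ p) (n : ℕ) (h : TRegular p lam) :
    v p n (dropCols (p - 1) lam) = ∏ q ∈ Finset.range (tConj p lam 1),
      vdm p n (q / (p - 1) - tailCard p lam q) (tailCard p lam q) := by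
  rw [v_eq_prod hp n h.dropCols,
    prod_tailCard hp h (fun q s => vdm p n (q / (p - 1) - s) s) fun q => vdm_zero p n _]
  refine Finset.prod_congr rfl fun q _ => ?_
  rw [Nat.add_div_right _ (by omega), Nat.add_sub_add_right]

/-- The correction term in the degree of the first operation, in terms of antidiagonals. -/
lemma sum_pNum_tailCard (hp : 2 ≤ p) {m : ℕ} (h : TRegular p lam) (hm : tConjLength p lam = m) :
    ∑ q ∈ Finset.range (tConj p lam 1), pNum p (tailCard p lam q) =
      ∑ j ∈ Finset.Icc 2 m, p ^ (j - 2) * tConj p lam j := by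
  induction m generalizing lam with
  | zero => simp [tConj_one_eq_zero hp h hm]
  | succ m ih =>
    have hm' : tConjLength p (dropCols (p - 1) lam) = m := by
      rw [tConjLength_dropCols hp, hm, Nat.add_sub_cancel]
    have ih' := ih h.dropCols hm'
    rw [sum_tailCard hp h (fun _ s => pNum p s) fun _ => pNum_zero p]
    simp only [pNum_succ' hp]
    rw [Finset.sum_add_distrib, ← Finset.mul_sum, ih', Finset.sum_const, Finset.card_range,
      smul_eq_mul, mul_one]
    rcases Nat.eq_zero_or_pos m with rfl | hmpos
    · simp [tConj_one_eq_zero hp h.dropCols hm']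
    · rw [← Finset.add_sum_Ioc_eq_sum_Icc (show 2 ≤ m + 1 by omega), Nat.sub_self, pow_zero,
        one_mul, tConj_dropCols le_rfl, add_comm, Finset.mul_sum]
      congr 1
      refine Finset.sum_bij' (fun j _ => j + 1) (fun j _ => j - 1) ?_ ?_ ?_ ?_ ?_
      · intro j hj; simp at hj ⊢; omega
      · intro j hj; simp at hj ⊢; omega
      · intro j hj; simp
      · intro j hj; simp at hj ⊢; omega
      · intro j hj
        rw [Finset.mem_Icc] at hj
        rw [tConj_dropCols (by omega), ← mul_assoc, ← pow_succ']
        congr 2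
        omega

/-- The lengths of the first `p - 1` columns. -/
lemma colLen_eq (hp : 2 ≤ p) (h : TRegular p lam) {N b : ℕ}
    (hγ : tConj p lam 1 = N * (p - 1) + b) (hb : b ≤ p - 1) {j : ℕ} (hj : j < p - 1) :
    lam.colLen j = if j < b then N + 1 else N := by
  refine eq_of_forall_lt_iff fun i => ?_
  have h1 := lt_tConj_one_iff hp h (i * (p - 1) + j)
  rw [mul_comm i, Nat.mul_add_mod, Nat.mod_eq_of_lt hj, Nat.mul_add_div (by omega),
    Nat.div_eq_of_lt hj, add_zero, hγ, mul_comm _ i] at h1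
  rw [← YoungDiagram.mem_iff_lt_colLen, YoungDiagram.mem_iff_lt_rowLen, ← h1]
  have hmono : ∀ {x y : ℕ}, x < y → x * (p - 1) + (p - 1) ≤ y * (p - 1) := by
    intro x y hxy
    have := Nat.mul_le_mul_right (p - 1) (Nat.succ_le_of_lt hxy)
    rwa [Nat.succ_mul] at this
  rcases lt_trichotomy i N with hlt | heq | hgt
  · have := hmono hlt
    split <;> omega
  · subst heq
    split <;> omega
  · have := hmono hgt
    split <;> omega

lemma prod_w_colLen (hp : 2 ≤ p) (n : ℕ) (h : TRegular p lam) {N b : ℕ}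
    (hγ : tConj p lam 1 = N * (p - 1) + b) (hb : b ≤ p - 1) :
    ∏ j ∈ Finset.range (p - 1), w p n (lam.colLen j) =
      w p n (N + 1) ^ b * w p n N ^ (p - 1 - b) := by
  rw [Finset.prod_congr rfl fun j hj => by
    rw [colLen_eq hp h hγ hb (Finset.mem_range.1 hj)]]
  nth_rw 1 [← Nat.add_sub_cancel' hb]
  rw [Finset.prod_range_add]
  congr 1
  · refine (Finset.prod_eq_pow_card (b := w p n (N + 1)) fun j hj => ?_).trans
      (by rw [Finset.card_range])
    rw [if_pos (Finset.mem_range.1 hj)]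
  · refine (Finset.prod_eq_pow_card (b := w p n N) fun j hj => ?_).trans
      (by rw [Finset.card_range])
    rw [if_neg (by omega)]

lemma wConj_eq_mul (n : ℕ) : wConj p n lam =
    wConj p n (dropCols (p - 1) lam) *
      ∏ j ∈ Finset.range (p - 1), w p n (lam.colLen j) := by
  have hsub : Finset.range (lam.rowLen 0) ⊆
      Finset.range ((p - 1) + (dropCols (p - 1) lam).rowLen 0) := by
    intro j hj
    rw [Finset.mem_range] at hj ⊢
    rw [rowLen_dropCols]
    omega
  rw [wConj, Finset.prod_subset hsub, Finset.prod_range_add, mul_comm, wConj]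
  · congr 1
    refine Finset.prod_congr rfl fun j _ => ?_
    rw [colLen_dropCols, add_comm]
  · intro j _ hj
    have : lam.colLen j = 0 := by
      by_contra hne
      have h1 := YoungDiagram.mem_iff_lt_colLen.2 (Nat.pos_of_ne_zero hne)
      rw [YoungDiagram.mem_iff_lt_rowLen] at h1
      exact hj (Finset.mem_range.2 h1)
    rw [this, w_zero]

end Peeling

section Composite

variable {p n : ℕ}

lemma hatComposite_congr {r r' : ℕ → ℕ} {m : ℕ} (h : ∀ k ∈ Finset.Icc 1 m, r k = r' k) :
    hatComposite p n r m = hatComposite p n r' m := by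
  induction m with
  | zero => rfl
  | succ m ih =>
    rw [hatComposite, hatComposite, h (m + 1) (by simp),
      ih fun k hk => h k (Finset.Icc_subset_Icc_right (Nat.le_succ m) hk)]

lemma hatComposite_succ' (r : ℕ → ℕ) (m : ℕ) :
    hatComposite p n r (m + 1) = hatComposite p n (fun k => r (k + 1)) m * hatP p n (r 1) := by
  induction m with
  | zero => simp [hatComposite]
  | succ m ih =>
    change hatP p n (r (m + 2)) * hatComposite p n r (m + 1) =
      hatP p n (r (m + 2)) * hatComposite p n (fun k => r (k + 1)) m * hatP p n (r 1)
    rw [ih, mul_assoc]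

variable [Fact p.Prime]

lemma hatComposite_mul (hp2 : p ≠ 2) {L : ℕ} {g : Poly p n} (hg : HatConstBelow p n L g)
    (r : ℕ → ℕ) (m : ℕ) (hr : ∀ k ∈ Finset.Icc 1 m, r k < L) (f : Poly p n) :
    hatComposite p n r m (f * g) = hatComposite p n r m f * g := by
  induction m with
  | zero => rfl
  | succ m ih =>
    change hatP p n (r (m + 1)) (hatComposite p n r m (f * g)) =
      hatP p n (r (m + 1)) (hatComposite p n r m f) * g
    rw [ih fun k hk => hr k (Finset.Icc_subset_Icc_right (Nat.le_succ m) hk),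
      hatP_mul_of_hatConstBelow hp2 hg (hr (m + 1) (by simp))]

/-- The factor split off with the first `p - 1` columns is a constant for all operations of the
degrees that can occur for a block of boxes shorter by at least `p - 1`. -/
lemma exists_hatConstBelow (N : ℕ) {b : ℕ} (hb : b ≤ p - 1) :
    ∃ L, HatConstBelow p n L (w p n (N + 1) ^ b * w p n N ^ (p - 1 - b)) ∧
      ∀ N' b' r, 1 ≤ b' → b' ≤ p - 1 → N' * (p - 1) + b' + (p - 1) ≤ N * (p - 1) + b →
        r ≤ (b' + 1) * pNum p N' → r < L := by
  have hp : p.Prime := Fact.out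
  have hd : 0 < p - 1 := by have := hp.two_le; omega
  cases N with
  | zero =>
    refine ⟨0, one_dvd _, fun N' b' r h1 _ h3 _ => ?_⟩
    rw [zero_mul] at h3
    omega
  | succ N =>
    have bound : ∀ N' b', b' ≤ p - 1 → N' * (p - 1) + b' + (p - 1) ≤ (N + 1) * (p - 1) + b →
        1 ≤ b' → (b' + 1) * pNum p N' ≤ (b + 1) * pNum p N := by
      intro N' b' hb' hle h1
      rw [add_mul N, one_mul] at hle
      rcases lt_trichotomy N' N with hlt | rfl | hgt
      · have h2 := pNum_mono hp.two_le (Nat.succ_le_of_lt hlt)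
        rw [Nat.succ_eq_add_one, pNum_succ' hp.two_le] at h2
        have h3 : (b' + 1) * pNum p N' ≤ p * pNum p N' := Nat.mul_le_mul_right _ (by omega)
        have h4 : 1 * pNum p N ≤ (b + 1) * pNum p N := Nat.mul_le_mul_right _ (by omega)
        omega
      · exact Nat.mul_le_mul_right _ (by omega)
      · have := Nat.mul_le_mul_right (p - 1) (Nat.succ_le_of_lt hgt)
        rw [Nat.succ_mul] at this
        omega
    have hN := sub_one_mul_pNum hp.two_le N
    rcases hb.eq_or_lt with rfl | hlt
    · refine ⟨p ^ (N + 1), ?_, fun N' b' r h1 h2 h3 h4 => ?_⟩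
      · rw [Nat.sub_self, pow_zero, mul_one]
        exact (hatConstBelow_w le_rfl).pow _
      · have := bound N' b' h2 h3 h1
        rw [Nat.sub_add_cancel hp.one_le, ← Nat.lt_succ_iff, Nat.succ_eq_add_one,
          ← pNum_succ' hp.two_le] at this
        have h5 := sub_one_mul_pNum hp.two_le (N + 1)
        have h6 : 1 * pNum p (N + 1) ≤ (p - 1) * pNum p (N + 1) := Nat.mul_le_mul_right _ hd
        omega
    · refine ⟨p ^ N, ?_, fun N' b' r h1 h2 h3 h4 => ?_⟩
      · exact ((hatConstBelow_w (Nat.pow_le_pow_right hp.pos (Nat.le_succ N))).pow _).mul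
          ((hatConstBelow_w le_rfl).pow _)
      · have := bound N' b' h2 h3 h1
        have h5 : (b + 1) * pNum p N ≤ (p - 1) * pNum p N := Nat.mul_le_mul_right _ (by omega)
        omega

/-- The statement in natural numbers, with `N k` one less than the number of rows of the `k`-th
block. -/
lemma exists_hatComposite_eq (hp2 : p ≠ 2) (m : ℕ) (lam : YoungDiagram)
    (hm : tConjLength p lam = m) (hlen : lam.colLen 0 ≤ n) (hreg : TRegular p lam) (N b : ℕ → ℕ)
    (hγ : ∀ k ∈ Finset.Icc 1 m,
      1 ≤ b k ∧ b k ≤ p - 1 ∧ tConj p lam k = N k * (p - 1) + b k) :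
    ∃ r : ℕ → ℕ,
      (∀ k ∈ Finset.Icc 1 m, r k + N k +
        ∑ j ∈ Finset.Icc (k + 1) m, p ^ (j - k - 1) * tConj p lam j =
          (b k + 1) * pNum p (N k)) ∧
      hatComposite p n r m (v p n lam) = wConj p n lam := by
  have hp : p.Prime := Fact.out
  have hd : 0 < p - 1 := by have := hp.two_le; omega
  induction m generalizing lam N b with
  | zero =>
    refine ⟨fun _ => 0, by simp, ?_⟩
    have h0 : lam.rowLen 0 = 0 := by
      rw [tConjLength, Nat.ceilDiv_eq_add_pred_div, Nat.div_eq_zero_iff] at hm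
      omega
    simp [hatComposite, v, wConj, tConj_one_eq_zero hp.two_le hreg hm, h0]
  | succ m ih =>
    have hm' : tConjLength p (dropCols (p - 1) lam) = m := by
      rw [tConjLength_dropCols hp.two_le, hm, Nat.add_sub_cancel]
    have hlen' : (dropCols (p - 1) lam).colLen 0 ≤ n := by
      rw [colLen_dropCols]
      exact (lam.colLen_anti _ _ (Nat.zero_le _)).trans hlen
    obtain ⟨r', hr', hcomp⟩ := ih (dropCols (p - 1) lam) hm' hlen' hreg.dropCols
      (fun k => N (k + 1)) (fun k => b (k + 1)) fun k hk => by
        rw [Finset.mem_Icc] at hk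
        rw [tConj_dropCols hk.1]
        exact hγ (k + 1) (Finset.mem_Icc.2 (by omega))
    obtain ⟨hb1, hb, hγ1⟩ := hγ 1 (by simp)
    set S := ∑ q ∈ Finset.range (tConj p lam 1), pNum p (tailCard p lam q) with hS
    have hSeq := sum_pNum_tailCard hp.two_le hreg hm
    have hN := sub_one_mul_pNum hp.two_le (N 1)
    -- `T = (b + 1) p_N - N` is the sum of the `p_i` over the boxes of the first block, `i` being
    -- the row counted from `0`; it bounds `S`, since antidiagonals have at most `i + 1` boxes.
    have hT := sum_pNum_div p (N := N 1) hb
    set T := ∑ q ∈ Finset.range (N 1 * (p - 1) + b 1), pNum p (q / (p - 1)) with hTdef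
    have hTN : T + N 1 = (b 1 + 1) * pNum p (N 1) := by
      refine Nat.eq_of_mul_eq_mul_left hd ?_
      have : (p - 1) * ((b 1 + 1) * pNum p (N 1)) + (b 1 + 1) = (b 1 + 1) * p ^ N 1 := by
        rw [← hN]; ring
      rw [mul_add, mul_comm _ (N 1)]
      omega
    have hST : S ≤ T := by
      rw [hS, hTdef, hγ1]
      exact Finset.sum_le_sum fun q _ => pNum_mono hp.two_le (tailCard_le hp.two_le q)
    have hNn : N 1 ≤ n := by
      have := colLen_eq hp.two_le hreg hγ1 hb hd
      rw [if_pos (by omega)] at this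
      omega
    have hfirst : hatP p n (T - S) (v p n lam) = v p n (dropCols (p - 1) lam) *
        (w p n (N 1 + 1) ^ b 1 * w p n (N 1) ^ (p - 1 - b 1)) := by
      rw [v_eq_prod hp.two_le n hreg, v_dropCols hp.two_le n hreg, hγ1]
      refine hatP_prod_vdm p n hp2 hb hNn hT (tailCard p lam)
        (fun q _ => tailCard_le hp.two_le q) ?_
      rw [← hγ1]
      omega
    obtain ⟨L, hconst, hL⟩ := exists_hatConstBelow (n := n) (N 1) hb
    refine ⟨fun k => if k = 1 then T - S else r' (k - 1), ?_, ?_⟩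
    · intro k hk
      rw [Finset.mem_Icc] at hk
      rcases hk.1.eq_or_lt with rfl | hlt
      · have : ∑ j ∈ Finset.Icc (1 + 1) (m + 1), p ^ (j - 1 - 1) * tConj p lam j = S := by
          rw [hS, hSeq]
          exact Finset.sum_congr rfl fun j _ => by rw [Nat.sub_sub]
        simp only [if_true, this]
        omega
      · obtain ⟨k, rfl⟩ : ∃ c, k = c + 1 := ⟨k - 1, by omega⟩
        simp only
        rw [if_neg (by omega), Nat.add_sub_cancel, ← hr' k (Finset.mem_Icc.2 (by omega))]
        congr 1
        rw [← Finset.map_add_right_Icc (k + 1) m 1, Finset.sum_map]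
        refine Finset.sum_congr rfl fun j hj => ?_
        rw [Finset.mem_Icc] at hj
        rw [tConj_dropCols (by omega), addRightEmbedding_apply, Nat.add_sub_add_right]
    · rw [hatComposite_succ', Module.End.mul_apply, if_pos rfl, hfirst]
      have hshift : ∀ k ∈ Finset.Icc 1 m,
          (if k + 1 = 1 then T - S else r' (k + 1 - 1)) < L := by
        intro k hk
        have hrk := hr' k hk
        rw [Finset.mem_Icc] at hk
        rw [if_neg (by omega), Nat.add_sub_cancel]
        obtain ⟨hbk1, hbk, hγk⟩ := hγ (k + 1) (Finset.mem_Icc.2 (by omega))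
        have hle := tConj_add_le hp.two_le hreg (k := k + 1) (by omega) (by omega)
        rw [hγk, hγ1] at hle
        exact hL _ _ _ hbk1 hbk hle (by omega)
      rw [hatComposite_mul hp2 hconst _ m hshift, wConj_eq_mul,
        prod_w_colLen hp.two_le n hreg hγ1 hb, ← hcomp]
      rw [hatComposite_congr fun k hk => ?_]
      rw [if_neg (by rw [Finset.mem_Icc] at hk; omega), Nat.add_sub_cancel]

end Composite

end SteenrodLinking

theorem mainTheorem1 (p : ℕ) [Fact p.Prime] (hp : p ≠ 2) (n : ℕ) (lam : YoungDiagram)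
    (hlen : lam.colLen 0 ≤ n) (hreg : SteenrodLinking.TRegular p lam)
    (N b : ℕ → ℕ)
    (hγ : ∀ k ∈ Finset.Icc 1 (SteenrodLinking.tConjLength p lam),
      1 ≤ N k ∧ 1 ≤ b k ∧ b k ≤ p - 1 ∧
        SteenrodLinking.tConj p lam k = (N k - 1) * (p - 1) + b k) :
    ∃ r : ℕ → ℕ,
      (∀ k ∈ Finset.Icc 1 (SteenrodLinking.tConjLength p lam),
        (r k : ℤ) = ((b k : ℤ) + 1) * (SteenrodLinking.pNum p (N k - 1) : ℤ) - ((N k : ℤ) - 1)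
          - ∑ j ∈ Finset.Icc (k + 1) (SteenrodLinking.tConjLength p lam),
              (p : ℤ) ^ (j - k - 1) * (SteenrodLinking.tConj p lam j : ℤ)) ∧
      SteenrodLinking.hatComposite p n r (SteenrodLinking.tConjLength p lam)
          (SteenrodLinking.v p n lam)
        = SteenrodLinking.wConj p n lam := by
  obtain ⟨r, hr, hcomp⟩ := SteenrodLinking.exists_hatComposite_eq hp _ lam rfl hlen hreg
    (fun k => N k - 1) b fun k hk => (hγ k hk).2
  refine ⟨r, fun k hk => ?_, hcomp⟩
  have h1 := congrArg (Nat.cast : ℕ → ℤ) (hr k hk)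
  push_cast [Nat.cast_sub (hγ k hk).1] at h1
  linarith
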